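/- **Setting.** Let $\mathcal M=(\mathcal S,\mathcal A,p,r)$ be an MDP whose state and action spaces are metric spaces with their Borel $\sigma$-algebras, with transition kernel $p$, measurable reward $r:\mathcal S\times\mathcal A\to[0,1]$ and initial law $\mu_0$ of $s_0$. Let $\rho$ be a metric on $\mathcal S\times\mathcal A$ with $\rho((s,a),(s',a'))\le\rho_{\mathcal S}(s,s')+\rho_{\mathcal A}(a,a')$, and let $\Phi\neq\emptyset$ be a class of stationary deterministic policies (measurable maps $\mathcal S\to\mathcal A$). Write $J(\phi)=\liminf_{T\to\infty}\frac1T\mathbb E[\sum_{t<T}r(s_t,\phi(s_t))]$ for the average reward of $\phi$ and put $J^\star=\sup_{\phi\in\Phi}J(\phi)$, $\Delta(\phi)=J^\star-J(\phi)$. *Lipschitz MDP (Assumption 1).* $|r(x)-r(y)|\le L_r\,\rho(x,y)$ and $\|p(x,\cdot)-p(y,\cdot)\|_{TV}\le L_p\,\rho(x,y)$ for all $x,y\in\mathcal S\times\mathcal A$, where $L_r,L_p\ge0$ and $\|\mu\|_{TV}=|\mu|(\mathcal S)$. *Uniform ergodicity (Assumption 2).* There are $C\in(0,\infty)$ and $\alpha\in(0,1)$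 such that for each $\phi\in\Phi$ there is a unique probability measure $\mu_\phi^{(\infty)}$ with $\|\mu^{(t)}_{\phi,s}-\mu^{(\infty)}_\phi\|_{TV}\le C\alpha^t$ for all $s\in\mathcal S$, $t\ge0$, where $\mu^{(t)}_{\phi,s}$ is the law of $s_t$ when $\phi$ is played from $s_0=s$. *Metric on $\Phi$.* Let $L_{J,\infty}=L_r+\frac{L_p}{2(1-\alpha)}(\max\{0,\lceil\log_{1/\alpha}C\rceil\}+1)$. The distance $\rho_\Phi$ and the constant $L_J$ are one of: (i) $\rho_\Phi(\phi,\psi)=\sup_s\rho_{\mathcal A}(\phi(s),\psi(s))$ and $L_J=L_{J,\infty}$; (ii) $\rho_\Phi(\phi,\psi)=\int\rho_{\mathcal A}(\phi(s),\psi(s))\,d\nu(s)$ and $L_J=\kappa L_{J,\infty}$, where $\nu$ is a probability measure and $\kappa>0$ with $\mu^{(\infty)}_\phi\le\kappa\nu$ for all $\phi\in\Phi$; (iii) any pseudometric $\rho_\Phi$ and any $L_J\ge0$ with $|J(\phi)-J(\psi)|\le L_J\,\rho_\Phi(\phi,\psi)$ on $\Phi$. *Zooming dimension.* Let $\mathcal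 N_\epsilon(X)$ be the least number of subsets of $X$ of $\rho_\Phi$-diameter at most $\epsilon$ that cover $X$. Let $C_{ub}\in\mathbb R$ be arbitrary, $c_z=2(\max\{2,C_{ub}\}+L_J)$, and let $c_{z_1},c_{z_2}>0$ be constants. With $\Phi_\gamma=\{\phi\in\Phi:\gamma<\Delta(\phi)\le2\gamma\}$ and $\Phi_{\le\gamma}=\{\phi\in\Phi:\Delta(\phi)\le\gamma\}$ let $$d_z^\Phi=\inf\{d'>0:\ \mathcal N_{\gamma/c_z}(\Phi_\gamma)\le c_{z_1}\gamma^{-d'}\text{ and }\mathcal N_{\gamma/c_z}(\Phi_{\le\gamma})\le c_{z_2}\gamma^{-d'}\text{ for all }0<\gamma\le1\},$$ and assume that this set of exponents is nonempty. *Algorithm PZRL-MF* (horizon $T\ge1$, confidence $\delta\in(0,1)$, constant $c_d$). Let $\phi_i$ be the policy played at time $i$, $N_t(\phi)$ the number of plays of $\phi$ before time $t$, $K_t(\phi)$ the number of episodes that began before time $t$ and in which $\phi$ is played, and $$\mathrm{diam}_t(\phi)=\tfrac{C}{1-\alpha}\Big(\sqrt{\tfrac{c_d\log(T/\delta)}{1\vee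 N_t(\phi)}}+\tfrac{1+K_t(\phi)}{1\vee N_t(\phi)}\Big),\qquad \mathrm{Index}_t(\phi)=\tfrac{1}{1\vee N_t(\phi)}\sum_{i<t}\mathbf 1\{\phi_i=\phi\}\,r(s_i,\phi(s_i))+(1+L_J)\,\mathrm{diam}_t(\phi).$$ The set of active policies is empty initially. At each time $t=0,\dots,T-1$: (1) as long as the balls $\{\psi\in\Phi:\rho_\Phi(\psi,\phi)\le\mathrm{diam}_t(\phi)\}$ around the active policies $\phi$ do not cover $\Phi$, an uncovered policy, returned by a covering oracle (a fixed map of the finite collection of balls), is activated; (2) if $t=0$ or the current episode is over, a new episode begins: an active policy $\phi$ of maximal index is chosen (ties broken arbitrarily on the basis of the information available), and the episode lasts $1\vee N_t(\phi)$ steps; (3) the action $a_t=\phi_t(s_t)$ of the policy $\phi_t$ of the current episode is played and $s_{t+1}\sim p(s_t,a_t,\cdot)$. The constant $c_d$ is required to satisfy $$c_d\ \ge\ \frac{\log\big(\frac{c_z}{\delta}\,2^{d_z^\Phi+2}\,T^{(d_z^\Phi+3)/(d_z^\Phi+2)}\big)}{\log(T/\delta)}.$$ **Theorem.** There are constants $K\in\mathbb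 R$ and $q\in\mathbb N$, depending only on $C,\alpha,L_J,C_{ub},c_{z_1},c_{z_2},c_d$ and $d_z^\Phi$, such that under Assumptions 1 and 2, for all $T\ge1$ and $\delta\in(0,1)$ for which $c_d$ satisfies the requirement above, with probability at least $1-\delta$ the regret of PZRL-MF satisfies $$T J^\star-\sum_{t=0}^{T-1}r(s_t,a_t)\ \le\ K\,\big(\log(T/\delta)\big)^q\;T^{\,1-\frac{1}{d_z^\Phi+2}}.$$ -/

import Mathlib

open MeasureTheory ProbabilityTheory Filter
open scoped ENNReal

noncomputable section

namespace PZRL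

/-! ### Markov decision processes and stationary deterministic policies -/

/-- A Markov decision process: a transition kernel and a measurable reward with values in `[0,1]`. -/
structure MDP (S A : Type*) [MeasurableSpace S] [MeasurableSpace A] where
  /-- transition kernel -/
  p : Kernel (S × A) S
  /-- transition probabilities -/
  markov : IsMarkovKernel p
  /-- reward function -/
  r : S × A → ℝ
  measurable_r : Measurable r
  r_mem : ∀ x, r x ∈ Set.Icc (0 : ℝ) 1

attribute [instance] MDP.markov

/-- Stationary deterministic policies: measurable maps from states to actions. -/
abbrev Policy (S A : Type*) [MeasurableSpace S] [MeasurableSpace A] :=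
  {φ : S → A // Measurable φ}

/-- Total variation norm of `μ - ν` (supremum over measurable partitions of the sum of the absolute
values of the masses; it is at most `2` for probability measures). -/
def tvDist {X : Type*} [MeasurableSpace X] (μ ν : Measure X) [IsFiniteMeasure μ]
    [IsFiniteMeasure ν] : ℝ≥0∞ :=
  (μ.toSignedMeasure - ν.toSignedMeasure).variation Set.univ

section MDPs

variable {S A : Type*} [MeasurableSpace S] [MeasurableSpace A]

/-- Transition kernel of the Markov chain obtained by playing `φ`. -/
def chainKernel (M : MDP S A) (φ : Policy S A) : Kernel S S :=
  M.p.comap (fun s => (s, φ.1 s)) (measurable_id.prodMk φ.2)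

instance (M : MDP S A) (φ : Policy S A) : IsMarkovKernel (chainKernel M φ) := by
  unfold chainKernel; infer_instance

/-- Law of the state at time `t` when `φ` is played and the initial state has law `μ₀`. -/
def stateLaw (M : MDP S A) (φ : Policy S A) (μ₀ : Measure S) : ℕ → Measure S
  | 0 => μ₀
  | t + 1 => (stateLaw M φ μ₀ t).bind (chainKernel M φ)

instance stateLaw_isProbabilityMeasure (M : MDP S A) (φ : Policy S A) (μ₀ : Measure S)
    [h : IsProbabilityMeasure μ₀] (t : ℕ) : IsProbabilityMeasure (stateLaw M φ μ₀ t) := by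
  induction t with
  | zero => exact h
  | succ t ih => unfold stateLaw; infer_instance

/-- Infinite horizon average reward of `φ`, the initial state having law `μ₀`. -/
def avgReward (M : MDP S A) (μ₀ : Measure S) (φ : Policy S A) : ℝ :=
  liminf (fun T : ℕ => (T : ℝ)⁻¹ *
    ∑ t ∈ Finset.range T, ∫ s, M.r (s, φ.1 s) ∂(stateLaw M φ μ₀ t)) atTop

/-- Best average reward over the class `Φ`. -/
def optReward (M : MDP S A) (μ₀ : Measure S) (Φ : Set (Policy S A)) : ℝ :=
  sSup (avgReward M μ₀ '' Φ)

/-- Suboptimality gap with respect to `Φ`. -/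
def gap (M : MDP S A) (μ₀ : Measure S) (Φ : Set (Policy S A)) (φ : Policy S A) : ℝ :=
  optReward M μ₀ Φ - avgReward M μ₀ φ

/-- `μ` is a uniformly geometric limit law of the chain of `φ`, with constants `C`, `α`. -/
def IsErgodicLimit (M : MDP S A) (C α : ℝ) (φ : Policy S A) (μ : ProbabilityMeasure S) : Prop :=
  ∀ (s : S) (t : ℕ),
    tvDist (stateLaw M φ (Measure.dirac s) t) (μ : Measure S) ≤ ENNReal.ofReal (C * α ^ t)

/-- Uniform ergodicity over the class `Φ`, with common constants `C`, `α`. -/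
def UniformlyErgodic (M : MDP S A) (C α : ℝ) (Φ : Set (Policy S A)) : Prop :=
  ∀ φ ∈ Φ, ∃! μ : ProbabilityMeasure S, IsErgodicLimit M C α φ μ

end MDPs

/-! ### Lipschitz MDPs and metrics on the policy class -/

/-- A metric on the product of two metric spaces that is dominated by the sum metric. -/
structure IsSubadditiveMetric {S A : Type*} [MetricSpace S] [MetricSpace A]
    (ρ : S × A → S × A → ℝ) : Prop where
  self : ∀ x, ρ x x = 0
  eq_of_eq_zero : ∀ x y, ρ x y = 0 → x = y
  symm : ∀ x y, ρ x y = ρ y x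
  triangle : ∀ x y z, ρ x z ≤ ρ x y + ρ y z
  subadd : ∀ x y, ρ x y ≤ dist x.1 y.1 + dist x.2 y.2

/-- Lipschitz reward and Lipschitz transition kernel (in total variation). -/
structure IsLipschitzMDP {S A : Type*} [MeasurableSpace S] [MeasurableSpace A] (M : MDP S A)
    (ρ : S × A → S × A → ℝ) (Lr Lp : ℝ) : Prop where
  nonneg_r : 0 ≤ Lr
  nonneg_p : 0 ≤ Lp
  reward : ∀ x y, |M.r x - M.r y| ≤ Lr * ρ x y
  kernel : ∀ x y, tvDist (M.p x) (M.p y) ≤ ENNReal.ofReal (Lp * ρ x y)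

section PolicyMetric

variable {S A : Type*} [MeasurableSpace S] [MeasurableSpace A]

/-- Sup-distance of policies. -/
def supMetric [MetricSpace A] (φ ψ : Policy S A) : ℝ≥0∞ := ⨆ s, edist (φ.1 s) (ψ.1 s)

/-- `ν`-weighted distance of policies. -/
def weightedMetric [MetricSpace A] (ν : Measure S) (φ ψ : Policy S A) : ℝ≥0∞ :=
  ∫⁻ s, edist (φ.1 s) (ψ.1 s) ∂ν

/-- Lipschitz constant of the average reward for the sup-distance. (The logarithm is nonnegative
unless there is only one state, so that rounding up to a natural number is harmless.) -/
def lipSup (C α Lr Lp : ℝ) : ℝ := Lr + Lp / (2 * (1 - α)) * (⌈Real.logb (1 / α) C⌉₊ + 1)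

/-- The choices of a metric on the policy class together with the constant `LJ` handed to the
algorithm: the sup-distance, the weighted distance for a probability measure that dominates all
stationary laws, or any (pseudo-)metric for which the average reward is `LJ`-Lipschitz on `Φ`. -/
def AdmissibleMetric [MetricSpace A] (M : MDP S A) (μ₀ : Measure S) (Φ : Set (Policy S A))
    (C α Lr Lp : ℝ) (ρΦ : Policy S A → Policy S A → ℝ≥0∞) (LJ : ℝ) : Prop :=
  (ρΦ = supMetric ∧ LJ = lipSup C α Lr Lp) ∨
  (∃ (ν : Measure S) (κ : ℝ), IsProbabilityMeasure ν ∧ 0 < κ ∧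
    (∀ φ ∈ Φ, ∀ ψ ∈ Φ, Measurable fun s => edist (φ.1 s) (ψ.1 s)) ∧
    (∀ φ ∈ Φ, ∀ μ : ProbabilityMeasure S, IsErgodicLimit M C α φ μ →
      ∀ B : Set S, MeasurableSet B → (μ : Measure S) B ≤ ENNReal.ofReal κ * ν B) ∧
    ρΦ = weightedMetric ν ∧ LJ = κ * lipSup C α Lr Lp) ∨
  ((∀ φ ∈ Φ, ρΦ φ φ = 0) ∧ (∀ φ ∈ Φ, ∀ ψ ∈ Φ, ρΦ φ ψ = ρΦ ψ φ) ∧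
    (∀ φ ∈ Φ, ∀ ψ ∈ Φ, ∀ χ ∈ Φ, ρΦ φ χ ≤ ρΦ φ ψ + ρΦ ψ χ) ∧ 0 ≤ LJ ∧
    (∀ φ ∈ Φ, ∀ ψ ∈ Φ, ENNReal.ofReal |avgReward M μ₀ φ - avgReward M μ₀ ψ| ≤
      ENNReal.ofReal LJ * ρΦ φ ψ))

end PolicyMetric

/-! ### Zooming dimension -/

/-- `ε`-covering number of `X`: smallest cardinality of a collection of subsets of `X` of diameter
at most `ε` that covers `X`. -/
def coveringNumber {P : Type*} (ρP : P → P → ℝ≥0∞) (ε : ℝ) (X : Set P) : ℕ∞ :=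
  ⨅ (𝒞 : Set (Set P)) (_ : (∀ U ∈ 𝒞, U ⊆ X ∧ ∀ x ∈ U, ∀ y ∈ U, ρP x y ≤ ENNReal.ofReal ε) ∧
    X ⊆ ⋃₀ 𝒞), 𝒞.encard

/-- The scale constant of the zooming dimension. -/
def scaleConst (Cub LJ : ℝ) : ℝ := 2 * (max 2 Cub + LJ)

section Zooming

variable {S A : Type*} [MeasurableSpace S] [MeasurableSpace A]

/-- Policies of `Φ` with gap in `(γ, 2γ]`. -/
def layer (M : MDP S A) (μ₀ : Measure S) (Φ : Set (Policy S A)) (γ : ℝ) : Set (Policy S A) :=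
  {φ ∈ Φ | gap M μ₀ Φ φ ∈ Set.Ioc γ (2 * γ)}

/-- Policies of `Φ` with gap at most `γ`. -/
def nearOpt (M : MDP S A) (μ₀ : Measure S) (Φ : Set (Policy S A)) (γ : ℝ) : Set (Policy S A) :=
  {φ ∈ Φ | gap M μ₀ Φ φ ≤ γ}

/-- Exponents `d' > 0` that control the covering numbers of near-optimal policies. -/
def zoomingSet (M : MDP S A) (μ₀ : Measure S) (Φ : Set (Policy S A))
    (ρΦ : Policy S A → Policy S A → ℝ≥0∞) (cz cz₁ cz₂ : ℝ) : Set ℝ :=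
  {d' | 0 < d' ∧ ∀ γ : ℝ, 0 < γ → γ ≤ 1 →
    (coveringNumber ρΦ (γ / cz) (layer M μ₀ Φ γ) : ℝ≥0∞) ≤ ENNReal.ofReal (cz₁ * γ ^ (-d')) ∧
    (coveringNumber ρΦ (γ / cz) (nearOpt M μ₀ Φ γ) : ℝ≥0∞) ≤ ENNReal.ofReal (cz₂ * γ ^ (-d'))}

/-- The zooming dimension (meaningful when `zoomingSet` is nonempty). -/
def zoomingDim (M : MDP S A) (μ₀ : Measure S) (Φ : Set (Policy S A))
    (ρΦ : Policy S A → Policy S A → ℝ≥0∞) (cz cz₁ cz₂ : ℝ) : ℝ :=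
  sInf (zoomingSet M μ₀ Φ ρΦ cz cz₁ cz₂)

end Zooming

/-! ### The algorithm PZRL-MF

In this section `π t` is the policy played at time `t` and `s t` is the state at time `t`, along
one trajectory. -/

section Algorithm

variable {P : Type*}

open Classical in
/-- Number of plays of `φ` before time `t`. -/
def playCount (π : ℕ → P) (t : ℕ) (φ : P) : ℕ := {i ∈ Finset.range t | π i = φ}.card

/-- The variables `(h, H)` (steps made in the current episode, length of the current episode) at
the beginning of iteration `t`. An iteration with `H ≤ h` starts an episode, whose length is the
number of previous plays of the chosen policy, and at least one. -/
def episodeState (π : ℕ → P) : ℕ → ℕ × ℕ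
  | 0 => (0, 0)
  | t + 1 =>
    if (episodeState π t).2 ≤ (episodeState π t).1 then (1, max 1 (playCount π t (π t)))
    else ((episodeState π t).1 + 1, (episodeState π t).2)

/-- An episode starts at time `t`. -/
def NewEpisode (π : ℕ → P) (t : ℕ) : Prop := (episodeState π t).2 ≤ (episodeState π t).1

open Classical in
/-- Number of episodes that began before time `t` and in which `φ` is played. -/
def episodeCount (π : ℕ → P) (t : ℕ) (φ : P) : ℕ :=
  {i ∈ Finset.range t | NewEpisode π i ∧ π i = φ}.card

/-- Diameter of `φ` at time `t`. -/
def policyDiam (C α cd δ : ℝ) (T : ℕ) (π : ℕ → P) (t : ℕ) (φ : P) : ℝ :=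
  C / (1 - α) * (√(cd * Real.log (T / δ) / (max 1 (playCount π t φ) : ℕ)) +
    (1 + episodeCount π t φ) / (max 1 (playCount π t φ) : ℕ))

/-- A covering oracle for `Φ`. Its input is a finite collection of balls (centre, radius); it
answers `none` if they cover `Φ`, and otherwise returns an uncovered element of `Φ`. -/
def IsCoveringOracle (Φ : Set P) (ρP : P → P → ℝ≥0∞) (O : Finset (P × ℝ) → Option P) : Prop :=
  ∀ B : Finset (P × ℝ),
    (O B = none → ∀ ψ ∈ Φ, ∃ b ∈ B, ρP ψ b.1 ≤ ENNReal.ofReal b.2) ∧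
    (∀ ψ, O B = some ψ → ψ ∈ Φ ∧ ∀ b ∈ B, ¬ ρP ψ b.1 ≤ ENNReal.ofReal b.2)

open Classical in
/-- `Activation O rad X Y`: starting from the active set `X` and repeatedly activating the policy
returned by the oracle for the balls of radius `rad` around the active policies, until they cover,
one arrives at the active set `Y`. -/
inductive Activation (O : Finset (P × ℝ) → Option P) (rad : P → ℝ) : Finset P → Finset P → Prop
  | done (X : Finset P) : O (X.image fun φ => (φ, rad φ)) = none → Activation O rad X X
  | step (X Y : Finset P) (ψ : P) : O (X.image fun φ => (φ, rad φ)) = some ψ →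
      Activation O rad (insert ψ X) Y → Activation O rad X Y

/-- The active set before the update at time `t`; it is empty initially. -/
def prevActive (act : ℕ → Finset P) : ℕ → Finset P
  | 0 => ∅
  | t + 1 => act t

variable {S A : Type*} [MeasurableSpace S] [MeasurableSpace A]

open Classical in
/-- Model-free UCB index of `φ` at time `t`. -/
def ucbIndex (M : MDP S A) (C α LJ cd δ : ℝ) (T : ℕ) (s : ℕ → S) (π : ℕ → Policy S A) (t : ℕ)
    (φ : Policy S A) : ℝ :=
  (∑ i ∈ Finset.range t, if π i = φ then M.r (s i, φ.1 (s i)) else 0) /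
    (max 1 (playCount π t φ) : ℕ) + (1 + LJ) * policyDiam C α cd δ T π t φ

/-- Along the state trajectory `s`, the played policies `π` and the active sets `act` follow
PZRL-MF up to the horizon `T`. Ties in the maximization of the index are broken arbitrarily. -/
structure IsRun (M : MDP S A) (O : Finset (Policy S A × ℝ) → Option (Policy S A))
    (C α LJ cd δ : ℝ) (T : ℕ) (s : ℕ → S) (π : ℕ → Policy S A)
    (act : ℕ → Finset (Policy S A)) : Prop where
  activate : ∀ t < T, Activation O (policyDiam C α cd δ T π t) (prevActive act t) (act t)
  choose : ∀ t < T, NewEpisode π t → π t ∈ act t ∧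
    ∀ ψ ∈ act t, ucbIndex M C α LJ cd δ T s π t ψ ≤ ucbIndex M C α LJ cd δ T s π t (π t)
  keep : ∀ t, t + 1 < T → ¬ NewEpisode π (t + 1) → π (t + 1) = π t

/-- The interaction of PZRL-MF with the MDP `M` up to time `T`, on a probability space `(Ω, P)`:
`s t` is the state at time `t`, with initial law `μ₀`; the policy `π t` is chosen from the
information `ℱ t` available at time `t`; the next state is drawn from the transition kernel at the
current state and action, conditionally on this information; every trajectory follows the
algorithm. -/
structure IsProcess {Ω : Type*} [mΩ : MeasurableSpace Ω] (P : Measure Ω) (M : MDP S A)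
    (μ₀ : Measure S) (O : Finset (Policy S A × ℝ) → Option (Policy S A)) (C α LJ cd δ : ℝ)
    (T : ℕ) (ℱ : Filtration ℕ mΩ) (s : ℕ → Ω → S) (π : ℕ → Ω → Policy S A)
    (act : ℕ → Ω → Finset (Policy S A)) : Prop where
  adapted_state : ∀ t < T, Measurable[ℱ t] (s t)
  adapted_policy : ∀ t < T, ∀ φ, MeasurableSet[ℱ t] {ω | π t ω = φ}
  initial : P.map (s 0) = μ₀
  transition : ∀ t, t + 1 < T → ∀ E, MeasurableSet[ℱ t] E → ∀ B : Set S, MeasurableSet B →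
    P (E ∩ s (t + 1) ⁻¹' B) = ∫⁻ ω in E, M.p (s t ω, (π t ω).1 (s t ω)) B ∂P
  run : ∀ ω, IsRun M O C α LJ cd δ T (fun t => s t ω) (fun t => π t ω) (fun t => act t ω)

/-- Regret against `Φ` up to time `T` along one trajectory. -/
def regret (M : MDP S A) (μ₀ : Measure S) (Φ : Set (Policy S A)) (T : ℕ) (s : ℕ → S)
    (π : ℕ → Policy S A) : ℝ :=
  T * optReward M μ₀ Φ - ∑ t ∈ Finset.range T, M.r (s t, (π t).1 (s t))

end Algorithm

end PZRL

end

/-!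
# Regret of PZRL-MF

Each policy `φ` of the class has a bounded relative value function `h`, the solution of the Poisson
equation `r - J(φ) = h - P h` (`bias_sub_integral_bias`), and `h` takes its values in an interval of
length `C / (1 - α)`. The rewards collected by `φ` therefore deviate from their long-run value by a
martingale with bounded differences and by sums of `h` at consecutive states, which telescope within
each episode (`abs_rewards_sub_le`). The martingale is controlled by Hoeffding's lemma and a union
bound over the time `k` of the first play and the number `n` of plays. There is no union over
policies: the covering oracle is deterministic, so the policy played at time `k` has finitely many
values, and the exponential bound can be applied on each of the events on which it takes a given
value (`IsProcess.measure_abs_deviation_le`). This makes a trajectory clean with probability at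
least `1 - δ` (`IsProcess.ofReal_le_measure_clean`).

On a clean trajectory indices are optimistic. The average reward is Lipschitz for the metric of the
class (`AdmissibleMetric.lipschitz`, by the performance difference formula) and the balls around the
active policies cover the class, so the gap of a policy is at most a multiple of its diameter
whenever it starts an episode. Episodes double the number of plays, so this extends to all times
(`IsRun.gap_le_policyDiam`), and it yields, for a policy with `N` plays, a contribution to the
regret of order `√(N log (T / δ))` (`IsRun.regret_le_sum_sqrt`). Of two active policies, the one
activated later was not covered by the ball around the other. Active policies with gaps in
`(γ, 2γ]` are thus separated, and their number is at most a covering number of that layer. Summing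
over dyadic layers above the scale `γ = T ^ (-1 / (d + 2))`, and using that a near-optimal policy
is either played often, which happens for few policies, or has a large diameter, gives the regret
bound on clean trajectories (`sum_le_of_layers`, `IsRun.regret_le`), with the first power of the
logarithm.
-/

noncomputable section

namespace PZRL

/-! ### Total variation and integrals -/

/-- A discrepancy on `B` counts twice in the total variation norm, as it recurs on the complement. -/
theorem two_mul_abs_real_sub_le_of_tvDist_le {X : Type*} [MeasurableSpace X] {μ ν : Measure X}
    [IsProbabilityMeasure μ] [IsProbabilityMeasure ν] {ε : ℝ} (hε : 0 ≤ ε)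
    (h : tvDist μ ν ≤ ENNReal.ofReal ε) {B : Set X} (hB : MeasurableSet B) :
    2 * |μ.real B - ν.real B| ≤ ε := by
  set σ := μ.toSignedMeasure - ν.toSignedMeasure with hσ
  have h1 : ∀ E, MeasurableSet E → σ E = μ.real E - ν.real E := by
    intro E hE
    simp [hσ, Measure.toSignedMeasure_apply_measurable hE]
  have h2 : ENNReal.ofReal |μ.real B - ν.real B| + ENNReal.ofReal |μ.real B - ν.real B|
      ≤ ENNReal.ofReal ε := by
    refine le_trans ?_ h
    unfold tvDist
    rw [← hσ, ← measure_add_measure_compl hB]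
    refine add_le_add ?_ ?_
    · refine le_trans (le_of_eq ?_) (VectorMeasure.enorm_measure_le_variation σ B)
      rw [h1 B hB, Real.enorm_eq_ofReal_abs]
    · refine le_trans (le_of_eq ?_) (VectorMeasure.enorm_measure_le_variation σ Bᶜ)
      rw [h1 _ hB.compl, Real.enorm_eq_ofReal_abs, probReal_compl_eq_one_sub hB,
        probReal_compl_eq_one_sub hB]
      congr 1
      rw [← abs_neg]; congr 1; ring
  rw [← ENNReal.ofReal_add (abs_nonneg _) (abs_nonneg _), ENNReal.ofReal_le_ofReal_iff hε] at h2
  linarith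

theorem integrable_of_abs_le {X : Type*} [MeasurableSpace X] (μ : Measure X) [IsFiniteMeasure μ]
    {f : X → ℝ} (hf : Measurable f) {b : ℝ} (hb : ∀ x, |f x| ≤ b) : Integrable f μ :=
  Integrable.of_bound hf.aestronglyMeasurable b (Eventually.of_forall hb)

/-- A function with values in `[0, L]` has integrals that differ by at most `L / 2` times the total
variation norm: integrate the discrepancies of its superlevel sets. -/
theorem abs_integral_sub_le_of_mem_Icc {X : Type*} [MeasurableSpace X] {μ ν : Measure X}
    [IsProbabilityMeasure μ] [IsProbabilityMeasure ν] {ε L : ℝ} (hε : 0 ≤ ε)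
    (h : tvDist μ ν ≤ ENNReal.ofReal ε) {f : X → ℝ} (hf : Measurable f) (hL : 0 ≤ L)
    (hfL : ∀ x, f x ∈ Set.Icc 0 L) :
    |∫ x, f x ∂μ - ∫ x, f x ∂ν| ≤ L * ε / 2 := by
  have hi : ∀ (η : Measure X) [IsProbabilityMeasure η], Integrable f η := fun η _ =>
    integrable_of_abs_le η hf (b := L) fun x => abs_le.2 ⟨by linarith [(hfL x).1], (hfL x).2⟩
  have e : ∀ (η : Measure X) [IsProbabilityMeasure η],
      ∫ x, f x ∂η = ∫ t in Set.Ioc 0 L, η.real {a | t ≤ f a} := fun η _ =>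
    (hi η).integral_eq_integral_Ioc_meas_le (Eventually.of_forall fun x => (hfL x).1)
      (Eventually.of_forall fun x => (hfL x).2)
  have hanti : ∀ (η : Measure X) [IsProbabilityMeasure η],
      IntegrableOn (fun t => η.real {a | t ≤ f a}) (Set.Ioc 0 L) := by
    intro η _
    have ha : Antitone fun t => η.real {a | t ≤ f a} := fun s t hst =>
      measureReal_mono (fun a (ha : t ≤ f a) => le_trans hst ha)
    exact Integrable.of_bound ha.measurable.aestronglyMeasurable 1
      (Eventually.of_forall fun t => by
        rw [Real.norm_eq_abs, abs_of_nonneg measureReal_nonneg]; exact measureReal_le_one)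
  rw [e μ, e ν, ← integral_sub (hanti μ) (hanti ν), ← Real.norm_eq_abs]
  refine le_trans (norm_setIntegral_le_of_norm_le_const (C := ε / 2) (by simp) ?_) ?_
  · intro t _
    rw [Real.norm_eq_abs]
    have := two_mul_abs_real_sub_le_of_tvDist_le hε h
      (measurableSet_le (measurable_const (a := t)) hf)
    linarith
  · simp [hL]; linarith

/-- Integrals of a function whose values differ by at most `L`, under two probability measures. -/
theorem abs_integral_sub_le_of_tvDist_le {X : Type*} [MeasurableSpace X] {μ ν : Measure X}
    [IsProbabilityMeasure μ] [IsProbabilityMeasure ν] {ε L : ℝ} (hε : 0 ≤ ε)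
    (h : tvDist μ ν ≤ ENNReal.ofReal ε) {f : X → ℝ} (hf : Measurable f)
    (hfL : ∀ x y, f x - f y ≤ L) :
    |∫ x, f x ∂μ - ∫ x, f x ∂ν| ≤ L * ε / 2 := by
  obtain ⟨x₀⟩ : Nonempty X := nonempty_of_isProbabilityMeasure μ
  have hL : 0 ≤ L := by simpa using hfL x₀ x₀
  have : Nonempty X := ⟨x₀⟩
  have hbdd : BddBelow (Set.range f) := ⟨f x₀ - L, by rintro _ ⟨x, rfl⟩; linarith [hfL x₀ x]⟩
  set a := ⨅ x, f x
  have hi : ∀ (η : Measure X) [IsProbabilityMeasure η], Integrable f η := fun η _ =>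
    integrable_of_abs_le η hf (b := |f x₀| + L) fun x => by
      have := abs_le.2 ⟨by linarith [hfL x₀ x], hfL x x₀⟩
      have := abs_add_le (f x₀) (f x - f x₀)
      rw [add_sub_cancel] at this; linarith
  have := abs_integral_sub_le_of_mem_Icc hε h (hf.sub_const a) hL fun x =>
    ⟨sub_nonneg.2 (ciInf_le hbdd x), by
      have : f x - L ≤ a := le_ciInf fun y => by linarith [hfL x y]
      linarith⟩
  rw [integral_sub (hi μ) (integrable_const _), integral_sub (hi ν) (integrable_const _)] at this
  simpa using this

/-! ### The Poisson equation of a uniformly ergodic policy -/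

section Poisson

variable {S A : Type*} [MeasurableSpace S] [MeasurableSpace A]

theorem abs_integral_le {X : Type*} [MeasurableSpace X] (μ : Measure X) [IsProbabilityMeasure μ]
    {f : X → ℝ} {b : ℝ} (h : ∀ x, |f x| ≤ b) : |∫ x, f x ∂μ| ≤ b := by
  have := norm_integral_le_of_norm_le_const (μ := μ) (f := f) (Eventually.of_forall h)
  simpa using this

theorem integral_stateLaw_succ (M : MDP S A) (φ : Policy S A) (μ : Measure S)
    [IsProbabilityMeasure μ] (t : ℕ) {f : S → ℝ} (hf : Measurable f) {b : ℝ}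
    (hb : ∀ x, |f x| ≤ b) :
    ∫ s, f s ∂(stateLaw M φ μ (t + 1)) =
      ∫ s, ∫ y, f y ∂(chainKernel M φ s) ∂(stateLaw M φ μ t) := by
  have h : stateLaw M φ μ (t + 1) =
      ((chainKernel M φ).comp (Kernel.const Unit (stateLaw M φ μ t))) () := by
    rw [← Measure.comp_eq_comp_const_apply]; rfl
  have hi := integrable_of_abs_le (stateLaw M φ μ (t + 1)) hf hb
  rw [h] at hi ⊢
  rw [Kernel.integral_comp hi, Kernel.const_apply]

/-- Expected reward at time `t` when `φ` is played from a given state. -/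
def expReward (M : MDP S A) (φ : Policy S A) : ℕ → S → ℝ
  | 0 => fun s => M.r (s, φ.1 s)
  | t + 1 => fun s => ∫ y, expReward M φ t y ∂(chainKernel M φ s)

theorem measurable_integral_chainKernel (M : MDP S A) (φ : Policy S A) {f : S → ℝ}
    (hf : Measurable f) : Measurable fun s => ∫ y, f y ∂(chainKernel M φ s) :=
  hf.stronglyMeasurable.integral_kernel.measurable

theorem measurable_expReward (M : MDP S A) (φ : Policy S A) (t : ℕ) :
    Measurable (expReward M φ t) := by
  induction t with
  | zero => exact M.measurable_r.comp (measurable_id.prodMk φ.2)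
  | succ t ih => exact measurable_integral_chainKernel M φ ih

theorem integral_mem_Icc {X : Type*} [MeasurableSpace X] (μ : Measure X) [IsProbabilityMeasure μ]
    {f : X → ℝ} (hf : Measurable f) (h : ∀ x, f x ∈ Set.Icc (0 : ℝ) 1) :
    ∫ x, f x ∂μ ∈ Set.Icc (0 : ℝ) 1 := by
  have hi := integrable_of_abs_le μ hf (b := 1) fun x => by
    rw [abs_of_nonneg (h x).1]; exact (h x).2
  refine ⟨integral_nonneg fun x => (h x).1, ?_⟩
  refine le_trans (integral_mono hi (integrable_const 1) fun x => (h x).2) ?_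
  simp

theorem expReward_mem_Icc (M : MDP S A) (φ : Policy S A) (t : ℕ) (s : S) :
    expReward M φ t s ∈ Set.Icc (0 : ℝ) 1 := by
  induction t generalizing s with
  | zero => exact M.r_mem _
  | succ t ih => exact integral_mem_Icc _ (measurable_expReward M φ t) ih

theorem abs_expReward_le (M : MDP S A) (φ : Policy S A) (t : ℕ) (s : S) :
    |expReward M φ t s| ≤ 1 := by
  have := expReward_mem_Icc M φ t s
  rw [abs_of_nonneg this.1]; exact this.2

theorem integral_expReward_stateLaw (M : MDP S A) (φ : Policy S A) (μ : Measure S)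
    [IsProbabilityMeasure μ] (t u : ℕ) :
    ∫ s, expReward M φ u s ∂(stateLaw M φ μ t) = ∫ s, expReward M φ (u + t) s ∂μ := by
  induction t generalizing u with
  | zero => rfl
  | succ t ih =>
    rw [integral_stateLaw_succ M φ μ t (measurable_expReward M φ u) (abs_expReward_le M φ u),
      show u + (t + 1) = (u + 1) + t by ring, ← ih (u + 1)]
    rfl

/-- The stationary reward of `φ`, computed with a limit law `μ` of its chain. -/
def statReward (M : MDP S A) (φ : Policy S A) (μ : ProbabilityMeasure S) : ℝ :=
  ∫ s, M.r (s, φ.1 s) ∂(μ : Measure S)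

variable {M : MDP S A} {C α : ℝ} {φ : Policy S A} {μ : ProbabilityMeasure S}

theorem abs_integral_stateLaw_sub_le (h : IsErgodicLimit M C α φ μ) (hC : 0 ≤ C) (hα : 0 ≤ α)
    {f : S → ℝ} (hf : Measurable f) {L : ℝ} (hL : ∀ x y, f x - f y ≤ L) (s : S) (t : ℕ) :
    |∫ x, f x ∂(stateLaw M φ (Measure.dirac s) t) - ∫ x, f x ∂(μ : Measure S)| ≤
      L * (C * α ^ t) / 2 :=
  abs_integral_sub_le_of_tvDist_le (by positivity) (h s t) hf hL

theorem abs_expReward_sub_le (h : IsErgodicLimit M C α φ μ) (hC : 0 ≤ C) (hα : 0 ≤ α)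
    (s : S) (t : ℕ) : |expReward M φ t s - statReward M φ μ| ≤ C * α ^ t / 2 := by
  have h1 := abs_integral_stateLaw_sub_le h hC hα (measurable_expReward M φ 0) (L := 1)
    (fun x y => by linarith [(expReward_mem_Icc M φ 0 x).2, (expReward_mem_Icc M φ 0 y).1]) s t
  rw [integral_expReward_stateLaw, integral_dirac' _ _
    (measurable_expReward M φ _).stronglyMeasurable, zero_add, one_mul] at h1
  exact h1

/-- The limit law is stationary, tested on bounded measurable functions. -/
theorem integral_integral_chainKernel (h : IsErgodicLimit M C α φ μ) (hC : 0 ≤ C) (hα : 0 ≤ α)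
    (hα' : α < 1) {f : S → ℝ} (hf : Measurable f) {b : ℝ} (hb : ∀ x, |f x| ≤ b) :
    ∫ s, ∫ y, f y ∂(chainKernel M φ s) ∂(μ : Measure S) = ∫ s, f s ∂(μ : Measure S) := by
  obtain ⟨s₀⟩ : Nonempty S := nonempty_of_isProbabilityMeasure (μ : Measure S)
  have key : ∀ {g : S → ℝ}, Measurable g → (∀ x, |g x| ≤ b) →
      Tendsto (fun t => ∫ x, g x ∂(stateLaw M φ (Measure.dirac s₀) t)) atTop
        (nhds (∫ x, g x ∂(μ : Measure S))) := by
    intro g hg hgb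
    rw [tendsto_iff_dist_tendsto_zero]
    refine squeeze_zero (fun t => dist_nonneg) (fun t => abs_integral_stateLaw_sub_le h hC hα hg
      (L := 2 * b) (fun x y => by
        linarith [(abs_le.1 (hgb x)).2, (abs_le.1 (hgb y)).1]) s₀ t) ?_
    have := (tendsto_pow_atTop_nhds_zero_of_lt_one hα hα').const_mul (2 * b * C / 2)
    rw [mul_zero] at this
    exact this.congr fun t => by ring
  have h1 := (key hf hb).comp (tendsto_add_atTop_nat 1)
  have h2 := key (measurable_integral_chainKernel M φ hf) fun x =>
    abs_integral_le (chainKernel M φ x) hb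
  refine tendsto_nhds_unique h2 (h1.congr fun t => ?_)
  exact integral_stateLaw_succ M φ _ t hf hb

/-- The average reward does not depend on the initial law: it is the stationary reward. -/
theorem avgReward_eq_statReward (h : IsErgodicLimit M C α φ μ) (hC : 0 ≤ C) (hα : 0 ≤ α)
    (hα' : α < 1) (μ₀ : Measure S) [IsProbabilityMeasure μ₀] :
    avgReward M μ₀ φ = statReward M φ μ := by
  have h0 : Tendsto (fun t => ∫ s, M.r (s, φ.1 s) ∂(stateLaw M φ μ₀ t)) atTop
      (nhds (statReward M φ μ)) := by
    rw [tendsto_iff_dist_tendsto_zero]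
    refine squeeze_zero (g := fun t => C * α ^ t / 2) (fun t => dist_nonneg) (fun t => ?_) ?_
    · have e : ∫ s, M.r (s, φ.1 s) ∂(stateLaw M φ μ₀ t) = ∫ s, expReward M φ t s ∂μ₀ := by
        have := integral_expReward_stateLaw M φ μ₀ t 0
        rwa [zero_add] at this
      have hi := integrable_of_abs_le μ₀ (measurable_expReward M φ t) (abs_expReward_le M φ t)
      have : ∫ s, expReward M φ t s ∂μ₀ - statReward M φ μ =
          ∫ s, (expReward M φ t s - statReward M φ μ) ∂μ₀ := by
        rw [integral_sub hi (integrable_const _)]; simp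
      rw [Real.dist_eq, e, this]
      exact abs_integral_le μ₀ fun s => abs_expReward_sub_le h hC hα s t
    · have := (tendsto_pow_atTop_nhds_zero_of_lt_one hα hα').const_mul (C / 2)
      rw [mul_zero] at this
      exact this.congr fun t => by ring
  exact h0.cesaro.liminf_eq

/-- The relative value function of `φ`: the total excess of the expected rewards over the
stationary reward. -/
def bias (M : MDP S A) (φ : Policy S A) (μ : ProbabilityMeasure S) (s : S) : ℝ :=
  ∑' t, (expReward M φ t s - statReward M φ μ)

theorem measurable_bias : Measurable (bias M φ μ) :=
  Measurable.tsum fun t => (measurable_expReward M φ t).sub_const _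

theorem hasSum_geometric_bound (C : ℝ) (hα : 0 ≤ α) (hα' : α < 1) :
    HasSum (fun t : ℕ => C * α ^ t / 2) (C / (2 * (1 - α))) := by
  have h := (hasSum_geometric_of_lt_one hα hα').mul_left (C / 2)
  rw [← div_eq_mul_inv, div_div] at h
  simpa only [div_mul_eq_mul_div] using h

theorem summable_bias (h : IsErgodicLimit M C α φ μ) (hC : 0 ≤ C) (hα : 0 ≤ α) (hα' : α < 1)
    (s : S) : Summable fun t => expReward M φ t s - statReward M φ μ :=
  Summable.of_norm_bounded (hasSum_geometric_bound C hα hα').summable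
    (abs_expReward_sub_le h hC hα s)

theorem abs_bias_le (h : IsErgodicLimit M C α φ μ) (hC : 0 ≤ C) (hα : 0 ≤ α) (hα' : α < 1)
    (s : S) : |bias M φ μ s| ≤ C / (2 * (1 - α)) :=
  (Real.norm_eq_abs _).symm.trans_le <|
    tsum_of_norm_bounded (hasSum_geometric_bound C hα hα') (abs_expReward_sub_le h hC hα s)

/-- The Poisson equation. -/
theorem bias_sub_integral_bias (h : IsErgodicLimit M C α φ μ) (hC : 0 ≤ C) (hα : 0 ≤ α)
    (hα' : α < 1) (s : S) :
    bias M φ μ s - ∫ y, bias M φ μ y ∂(chainKernel M φ s) =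
      M.r (s, φ.1 s) - statReward M φ μ := by
  have hi : ∀ t, Integrable (fun y => expReward M φ t y - statReward M φ μ)
      (chainKernel M φ s) := fun t =>
    integrable_of_abs_le _ ((measurable_expReward M φ t).sub_const _)
      (abs_expReward_sub_le h hC hα · t)
  have e : ∫ y, bias M φ μ y ∂(chainKernel M φ s) =
      ∑' t, (expReward M φ (t + 1) s - statReward M φ μ) := by
    unfold bias
    rw [← integral_tsum_of_summable_integral_norm hi]
    · refine tsum_congr fun t => ?_
      rw [integral_sub (integrable_of_abs_le _ (measurable_expReward M φ t)
        (abs_expReward_le M φ t)) (integrable_const _)]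
      simp [expReward]
    · refine Summable.of_nonneg_of_le (fun t => integral_nonneg fun y => norm_nonneg _) (fun t => ?_)
        (hasSum_geometric_bound C hα hα').summable
      refine le_trans (integral_mono (hi t).norm (integrable_const _)
        fun y => abs_expReward_sub_le h hC hα y t) ?_
      simp
  rw [e]
  unfold bias
  rw [(summable_bias h hC hα hα' s).tsum_eq_zero_add]
  simp [expReward]

/-- A bound on the span of the relative value function that does not deteriorate with `C`: the
first terms of the series have span at most `1`, until the geometric decay takes over. -/
theorem bias_sub_bias_le (h : IsErgodicLimit M C α φ μ) (hC : 0 < C) (hα : 0 < α) (hα' : α < 1)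
    (s s' : S) :
    bias M φ μ s - bias M φ μ s' ≤ (⌈Real.logb (1 / α) C⌉₊ + 1) / (1 - α) := by
  set n := ⌈Real.logb (1 / α) C⌉₊ with hn
  have h1α : 0 < 1 - α := by linarith
  have hCn : C * α ^ n ≤ 1 := by
    have h1 : 1 < 1 / α := by rw [lt_div_iff₀ hα]; linarith
    have h2 : C ≤ (1 / α) ^ n := by
      rw [← Real.rpow_natCast, ← Real.logb_le_iff_le_rpow h1 hC]
      exact Nat.le_ceil _
    calc C * α ^ n ≤ (1 / α) ^ n * α ^ n := by gcongr
      _ = 1 := by rw [← mul_pow]; simp [hα.ne']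
  have hs := summable_bias h hC.le hα.le hα' s
  have hs' := summable_bias h hC.le hα.le hα' s'
  unfold bias
  rw [← hs.tsum_sub hs', ← (hs.sub hs').sum_add_tsum_nat_add n, add_div]
  have hn1 : (n : ℝ) ≤ n / (1 - α) := by
    rw [le_div_iff₀ h1α]
    nlinarith [(Nat.cast_nonneg n : (0 : ℝ) ≤ n)]
  refine add_le_add (le_trans ?_ hn1) ?_
  · refine le_trans (Finset.sum_le_card_nsmul _ _ 1 fun t _ => ?_) (by simp)
    linarith [(expReward_mem_Icc M φ t s).2, (expReward_mem_Icc M φ t s').1]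
  · have hg := hasSum_geometric_of_lt_one hα.le hα'
    rw [one_div, ← hg.tsum_eq]
    refine Summable.tsum_le_tsum (fun t => ?_)
      ((summable_nat_add_iff n).2 (hs.sub hs')) hg.summable
    have a1 := (abs_le.1 (abs_expReward_sub_le h hC.le hα.le s (t + n))).2
    have a2 := (abs_le.1 (abs_expReward_sub_le h hC.le hα.le s' (t + n))).1
    have : C * α ^ (t + n) ≤ α ^ t := by
      calc C * α ^ (t + n) = (C * α ^ n) * α ^ t := by ring
        _ ≤ 1 * α ^ t := by gcongr
        _ = α ^ t := one_mul _
    linarith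

end Poisson

/-! ### Lipschitz continuity of the average reward -/

section Lipschitz

variable {S A : Type*} [MeasurableSpace S] [MeasurableSpace A] {M : MDP S A}
  {C α : ℝ} {φ ψ : Policy S A} {μ ν : ProbabilityMeasure S}

theorem lipSup_nonneg {C α Lr Lp : ℝ} (hα' : α < 1) (hr : 0 ≤ Lr) (hp : 0 ≤ Lp) :
    0 ≤ lipSup C α Lr Lp := by
  have : 0 < 1 - α := by linarith
  unfold lipSup
  positivity

/-- The performance difference formula: the stationary law of `ψ` is integrated against the
one-step advantage of `ψ` over `φ`, computed with the relative value function of `φ`. -/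
theorem statReward_sub_statReward (h : IsErgodicLimit M C α φ μ) (h' : IsErgodicLimit M C α ψ ν)
    (hC : 0 ≤ C) (hα : 0 ≤ α) (hα' : α < 1) :
    statReward M ψ ν - statReward M φ μ =
      ∫ s, ((M.r (s, ψ.1 s) - M.r (s, φ.1 s)) + (∫ y, bias M φ μ y ∂(chainKernel M ψ s) -
        ∫ y, bias M φ μ y ∂(chainKernel M φ s))) ∂(ν : Measure S) := by
  have hb := abs_bias_le h hC hα hα'
  have i1 := integrable_of_abs_le (ν : Measure S) (measurable_expReward M ψ 0)
    (abs_expReward_le M ψ 0)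
  have i2 := integrable_of_abs_le (ν : Measure S)
    (measurable_integral_chainKernel M ψ (measurable_bias (φ := φ) (M := M) (μ := μ)))
    fun s => abs_integral_le _ hb
  have i3 := integrable_of_abs_le (ν : Measure S) (measurable_bias (φ := φ) (M := M) (μ := μ)) hb
  have e : ∀ s, (M.r (s, ψ.1 s) - M.r (s, φ.1 s)) + (∫ y, bias M φ μ y ∂(chainKernel M ψ s) -
        ∫ y, bias M φ μ y ∂(chainKernel M φ s)) =
      (expReward M ψ 0 s + ∫ y, bias M φ μ y ∂(chainKernel M ψ s)) - bias M φ μ s -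
        statReward M φ μ := by
    intro s
    have := bias_sub_integral_bias h hC hα hα' s
    simp only [expReward]
    linarith
  simp_rw [e]
  have i12 : Integrable (fun s => expReward M ψ 0 s + ∫ y, bias M φ μ y ∂(chainKernel M ψ s))
    (ν : Measure S) := i1.add i2
  have i123 : Integrable (fun s => (expReward M ψ 0 s +
    ∫ y, bias M φ μ y ∂(chainKernel M ψ s)) - bias M φ μ s) (ν : Measure S) := i12.sub i3
  rw [integral_sub i123 (integrable_const _), integral_sub i12 i3, integral_add i1 i2,
    integral_integral_chainKernel h' hC hα hα' measurable_bias hb]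
  simp [statReward, expReward]

theorem ofReal_abs_statReward_sub_le [MetricSpace S] [MetricSpace A]
    {ρ : S × A → S × A → ℝ} {Lr Lp : ℝ}
    (hρ : IsSubadditiveMetric ρ) (hM : IsLipschitzMDP M ρ Lr Lp)
    (h : IsErgodicLimit M C α φ μ) (h' : IsErgodicLimit M C α ψ ν)
    (hC : 0 < C) (hα : 0 < α) (hα' : α < 1) :
    ENNReal.ofReal |statReward M φ μ - statReward M ψ ν| ≤
      ∫⁻ s, ENNReal.ofReal (lipSup C α Lr Lp) * edist (φ.1 s) (ψ.1 s) ∂(ν : Measure S) := by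
  rw [abs_sub_comm, statReward_sub_statReward h h' hC.le hα.le hα', ← Real.enorm_eq_ofReal_abs]
  refine le_trans (enorm_integral_le_lintegral_enorm _) (lintegral_mono fun s => ?_)
  rw [Real.enorm_eq_ofReal_abs, edist_dist,
    ← ENNReal.ofReal_mul (lipSup_nonneg hα' hM.nonneg_r hM.nonneg_p)]
  refine ENNReal.ofReal_le_ofReal ?_
  have hd : ρ (s, ψ.1 s) (s, φ.1 s) ≤ dist (φ.1 s) (ψ.1 s) := by
    have := hρ.subadd (s, ψ.1 s) (s, φ.1 s)
    rwa [dist_self, zero_add, dist_comm] at this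
  have h1 : |M.r (s, ψ.1 s) - M.r (s, φ.1 s)| ≤ Lr * dist (φ.1 s) (ψ.1 s) :=
    (hM.reward _ _).trans (mul_le_mul_of_nonneg_left hd hM.nonneg_r)
  have h2 := abs_integral_sub_le_of_tvDist_le (μ := chainKernel M ψ s) (ν := chainKernel M φ s)
    (ε := Lp * dist (φ.1 s) (ψ.1 s)) (mul_nonneg hM.nonneg_p dist_nonneg)
    ((hM.kernel (s, ψ.1 s) (s, φ.1 s)).trans
      (ENNReal.ofReal_le_ofReal (mul_le_mul_of_nonneg_left hd hM.nonneg_p)))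
    measurable_bias (bias_sub_bias_le h hC hα hα')
  refine (abs_add_le _ _).trans ((add_le_add h1 h2).trans (le_of_eq ?_))
  have : 1 - α ≠ 0 := by linarith
  unfold lipSup
  field_simp

/-- For each admissible metric the average reward is Lipschitz on the class, with the constant that
is handed to the algorithm. -/
theorem AdmissibleMetric.lipschitz [MetricSpace S] [MetricSpace A]
    {ρ : S × A → S × A → ℝ} {Lr Lp LJ : ℝ} {Φ : Set (Policy S A)}
    {ρΦ : Policy S A → Policy S A → ℝ≥0∞} {μ₀ : Measure S} [IsProbabilityMeasure μ₀]
    (hadm : AdmissibleMetric M μ₀ Φ C α Lr Lp ρΦ LJ)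
    (hρ : IsSubadditiveMetric ρ) (hM : IsLipschitzMDP M ρ Lr Lp) (hE : UniformlyErgodic M C α Φ)
    (hC : 0 < C) (hα : 0 < α) (hα' : α < 1) :
    0 ≤ LJ ∧ ∀ φ ∈ Φ, ∀ ψ ∈ Φ,
      ENNReal.ofReal |avgReward M μ₀ φ - avgReward M μ₀ ψ| ≤ ENNReal.ofReal LJ * ρΦ φ ψ := by
  have hL := lipSup_nonneg (C := C) hα' hM.nonneg_r hM.nonneg_p
  obtain ⟨rfl, rfl⟩ | ⟨ν, κ, hν, hκ, hm, hdom, rfl, rfl⟩ | ⟨-, -, -, h0, hJ⟩ := hadm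
  · refine ⟨hL, fun φ hφ ψ hψ => ?_⟩
    obtain ⟨μ, h, -⟩ := hE φ hφ
    obtain ⟨μ', h', -⟩ := hE ψ hψ
    rw [avgReward_eq_statReward h hC.le hα.le hα', avgReward_eq_statReward h' hC.le hα.le hα']
    refine (ofReal_abs_statReward_sub_le hρ hM h h' hC hα hα').trans ?_
    refine (lintegral_mono fun s => mul_le_mul_right
      (le_iSup (fun s => edist (φ.1 s) (ψ.1 s)) s) _).trans ?_
    simp [supMetric]
  · refine ⟨mul_nonneg hκ.le hL, fun φ hφ ψ hψ => ?_⟩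
    obtain ⟨μ, h, -⟩ := hE φ hφ
    obtain ⟨μ', h', -⟩ := hE ψ hψ
    rw [avgReward_eq_statReward h hC.le hα.le hα', avgReward_eq_statReward h' hC.le hα.le hα']
    refine (ofReal_abs_statReward_sub_le hρ hM h h' hC hα hα').trans ?_
    have hle : (μ' : Measure S) ≤ ENNReal.ofReal κ • ν :=
      Measure.le_iff.2 fun B hB => hdom ψ hψ μ' h' B hB
    rw [lintegral_const_mul _ (hm φ hφ ψ hψ), ENNReal.ofReal_mul hκ.le, mul_comm (ENNReal.ofReal κ),
      mul_assoc]
    refine mul_le_mul_right ((lintegral_mono' hle le_rfl).trans ?_) _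
    rw [lintegral_smul_measure, smul_eq_mul, weightedMetric]
  · exact ⟨h0, hJ⟩

end Lipschitz

/-! ### Episodes and play counts along a trajectory -/

section Episodes

variable {P : Type*} {π π' : ℕ → P} {t T : ℕ} {φ : P}

open Classical in
theorem playCount_succ (π : ℕ → P) (t : ℕ) (φ : P) :
    playCount π (t + 1) φ = playCount π t φ + if π t = φ then 1 else 0 := by
  unfold playCount
  rw [Finset.range_add_one, Finset.filter_insert]
  split_ifs <;> simp

open Classical in
theorem episodeCount_succ (π : ℕ → P) (t : ℕ) (φ : P) :
    episodeCount π (t + 1) φ =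
      episodeCount π t φ + if NewEpisode π t ∧ π t = φ then 1 else 0 := by
  unfold episodeCount
  rw [Finset.range_add_one, Finset.filter_insert]
  split_ifs <;> simp

theorem playCount_mono (π : ℕ → P) (φ : P) : Monotone fun t => playCount π t φ :=
  monotone_nat_of_le_succ fun t => by rw [playCount_succ]; exact Nat.le_add_right _ _

theorem playCount_eq_sum (π : ℕ → P) (t : ℕ) (φ : P) [DecidablePred fun j => π j = φ] :
    playCount π t φ = ∑ j ∈ Finset.range t, if π j = φ then 1 else 0 := by
  unfold playCount
  rw [Finset.card_filter]
  congr!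

theorem playCount_le (π : ℕ → P) (t : ℕ) (φ : P) : playCount π t φ ≤ t := by
  classical
  unfold playCount
  exact (Finset.card_filter_le _ _).trans (Finset.card_range t).le

theorem exists_lt_of_playCount_pos (h : 0 < playCount π t φ) : ∃ j < t, π j = φ := by
  classical
  obtain ⟨j, hj⟩ := Finset.card_pos.1 h
  exact ⟨j, Finset.mem_range.1 (Finset.mem_filter.1 hj).1, (Finset.mem_filter.1 hj).2⟩

theorem playCount_congr (h : ∀ i < t, π i = π' i) (φ : P) :
    playCount π t φ = playCount π' t φ := by
  classical
  unfold playCount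
  congr 1
  exact Finset.filter_congr fun i hi => by rw [h i (Finset.mem_range.1 hi)]

theorem episodeState_congr (h : ∀ i < t, π i = π' i) :
    episodeState π t = episodeState π' t := by
  induction t with
  | zero => rfl
  | succ t ih =>
    have ht := ih fun i hi => h i (hi.trans t.lt_succ_self)
    simp only [episodeState]
    rw [ht, ← h t t.lt_succ_self,
      playCount_congr fun i hi => h i (hi.trans t.lt_succ_self)]

theorem episodeCount_congr (h : ∀ i < t, π i = π' i) (φ : P) :
    episodeCount π t φ = episodeCount π' t φ := by
  classical
  unfold episodeCount
  congr 1
  exact Finset.filter_congr fun i hi => by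
    rw [h i (Finset.mem_range.1 hi), NewEpisode, NewEpisode,
      episodeState_congr fun j hj => h j (hj.trans (Finset.mem_range.1 hi))]

theorem policyDiam_congr (C α cd δ : ℝ) (T : ℕ) (h : ∀ i < t, π i = π' i) :
    policyDiam C α cd δ T π t = policyDiam C α cd δ T π' t := by
  funext φ
  unfold policyDiam
  rw [playCount_congr h, episodeCount_congr h]

/-- Number of plays of a policy after `k` complete episodes: episodes double it. -/
def doublingCount : ℕ → ℕ
  | 0 => 0
  | k + 1 => 2 ^ k

theorem doublingCount_succ (k : ℕ) :
    doublingCount (k + 1) = doublingCount k + max 1 (doublingCount k) := by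
  cases k with
  | zero => rfl
  | succ k =>
    have : 1 ≤ 2 ^ k := Nat.one_le_two_pow
    simp only [doublingCount]
    rw [max_eq_right this, pow_succ]; ring

theorem max_one_doublingCount (k : ℕ) : max 1 (doublingCount k) = 2 ^ (k - 1) := by
  cases k with
  | zero => rfl
  | succ k => exact max_eq_right Nat.one_le_two_pow

/-- The state of the counters after step `u`: the policy `π u` of the current episode had `k`
episodes before, all other policies only have complete episodes. -/
def EpisodeCounters (π : ℕ → P) (u : ℕ) : Prop :=
  ∃ k, episodeCount π (u + 1) (π u) = k + 1 ∧
    (episodeState π (u + 1)).2 = max 1 (doublingCount k) ∧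
    playCount π (u + 1) (π u) = doublingCount k + (episodeState π (u + 1)).1 ∧
    1 ≤ (episodeState π (u + 1)).1 ∧
    (episodeState π (u + 1)).1 ≤ (episodeState π (u + 1)).2 ∧
    ∀ φ, φ ≠ π u → playCount π (u + 1) φ = doublingCount (episodeCount π (u + 1) φ)

theorem episodeCounters_of_newEpisode {v : ℕ} (hv : NewEpisode π v)
    (hN : ∀ φ, playCount π v φ = doublingCount (episodeCount π v φ)) : EpisodeCounters π v := by
  have hes : episodeState π (v + 1) = (1, max 1 (playCount π v (π v))) := by
    rw [episodeState, if_pos (show _ ≤ _ from hv)]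
  refine ⟨episodeCount π v (π v), ?_, ?_, ?_, ?_, ?_, ?_⟩
  · rw [episodeCount_succ, if_pos ⟨hv, rfl⟩]
  · rw [hes, hN]
  · rw [playCount_succ, if_pos rfl, hN, hes]
  · rw [hes]
  · rw [hes]; exact le_max_left _ _
  · intro φ hφ
    rw [playCount_succ, episodeCount_succ, if_neg hφ.symm, if_neg fun h => hφ h.2.symm]
    exact hN φ

theorem episodeCounters
    (hkeep : ∀ t, t + 1 < T → ¬ NewEpisode π (t + 1) → π (t + 1) = π t) (u : ℕ) (hu : u < T) :
    EpisodeCounters π u := by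
  induction u with
  | zero =>
    refine episodeCounters_of_newEpisode (by simp [NewEpisode, episodeState])
      fun φ => by simp [playCount, episodeCount, doublingCount]
  | succ u ih =>
    obtain ⟨k, hK, hH, hN, h1, hle, hother⟩ := ih (by lia)
    by_cases hnew : NewEpisode π (u + 1)
    · refine episodeCounters_of_newEpisode hnew fun φ => ?_
      by_cases hφ : φ = π u
      · subst hφ
        have : (episodeState π (u + 1)).1 = max 1 (doublingCount k) :=
          hH ▸ le_antisymm hle hnew
        rw [hN, hK, this, doublingCount_succ]
      · exact hother φ hφ
    · have hπ := hkeep u hu hnew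
      have hlt : (episodeState π (u + 1)).1 < (episodeState π (u + 1)).2 := not_le.1 hnew
      have hes : episodeState π (u + 1 + 1) =
          ((episodeState π (u + 1)).1 + 1, (episodeState π (u + 1)).2) := by
        rw [episodeState, if_neg (not_le.2 hlt)]
      refine ⟨k, ?_, ?_, ?_, ?_, ?_, ?_⟩
      · rw [episodeCount_succ, if_neg fun h => hnew h.1, hπ, hK]
      · rw [hes, hH]
      · rw [playCount_succ, if_pos rfl, hπ, hN, hes, add_assoc]
      · rw [hes]; exact Nat.le_add_left _ _
      · rw [hes]; exact hlt
      · intro φ hφ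
        rw [playCount_succ, episodeCount_succ, if_neg hφ.symm, if_neg fun h => hnew h.1]
        exact hother φ (hπ ▸ hφ)

theorem playCount_eq_of_newEpisode
    (hkeep : ∀ t, t + 1 < T → ¬ NewEpisode π (t + 1) → π (t + 1) = π t) (ht : t ≤ T)
    (hnew : NewEpisode π t) (φ : P) : playCount π t φ = doublingCount (episodeCount π t φ) := by
  cases t with
  | zero => simp [playCount, episodeCount, doublingCount]
  | succ u =>
    obtain ⟨k, hK, hH, hN, h1, hle, hother⟩ := episodeCounters hkeep u ht
    by_cases hφ : φ = π u
    · subst hφ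
      have : (episodeState π (u + 1)).1 = max 1 (doublingCount k) := hH ▸ le_antisymm hle hnew
      rw [hN, hK, this, doublingCount_succ]
    · exact hother φ hφ

theorem playCount_eq_zero
    (hkeep : ∀ t, t + 1 < T → ¬ NewEpisode π (t + 1) → π (t + 1) = π t) (ht : t ≤ T)
    (h0 : episodeCount π t φ = 0) : playCount π t φ = 0 := by
  cases t with
  | zero => simp [playCount]
  | succ u =>
    obtain ⟨k, hK, hH, hN, h1, hle, hother⟩ := episodeCounters hkeep u ht
    by_cases hφ : φ = π u
    · subst hφ; lia
    · rw [hother φ hφ, h0, doublingCount]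

/-- With `k + 1` episodes, the last one possibly incomplete, the number of plays is more than it
was after `k` episodes and at most what it will be after the current one. -/
theorem playCount_mem_Ioc
    (hkeep : ∀ t, t + 1 < T → ¬ NewEpisode π (t + 1) → π (t + 1) = π t) (ht : t ≤ T) {k : ℕ}
    (hk : episodeCount π t φ = k + 1) :
    playCount π t φ ∈ Set.Ioc (doublingCount k) (doublingCount (k + 1)) := by
  have hlt : doublingCount k < doublingCount (k + 1) := by
    rw [doublingCount_succ]; lia
  cases t with
  | zero => simp [episodeCount] at hk
  | succ u =>
    obtain ⟨k', hK, hH, hN, h1, hle, hother⟩ := episodeCounters hkeep u ht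
    by_cases hφ : φ = π u
    · subst hφ
      obtain rfl : k' = k := by lia
      rw [hN, doublingCount_succ]
      exact ⟨by lia, by lia⟩
    · rw [hother φ hφ, hk]; exact ⟨hlt, le_rfl⟩

end Episodes

/-! ### Active sets -/

section Active

variable {P : Type*} {O : Finset (P × ℝ) → Option P} {rad : P → ℝ} {X Y : Finset P}
  {Φ : Set P} {ρP : P → P → ℝ≥0∞}

open Classical in
theorem Activation.subset (h : Activation O rad X Y) : X ⊆ Y := by
  induction h with
  | done X _ => exact subset_rfl
  | step X Y ψ _ _ ih => exact (Finset.subset_insert _ _).trans ih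

open Classical in
theorem Activation.subset_class (h : Activation O rad X Y) (hO : IsCoveringOracle Φ ρP O)
    (hX : (X : Set P) ⊆ Φ) : (Y : Set P) ⊆ Φ := by
  induction h with
  | done X _ => exact hX
  | step X Y ψ hψ _ ih =>
    refine ih ?_
    rw [Finset.coe_insert]
    exact Set.insert_subset ((hO _).2 ψ hψ).1 hX

theorem Activation.exists_le (h : Activation O rad X Y) (hO : IsCoveringOracle Φ ρP O) {ψ : P}
    (hψ : ψ ∈ Φ) : ∃ φ ∈ Y, ρP ψ φ ≤ ENNReal.ofReal (rad φ) := by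
  classical
  induction h with
  | done X hX =>
    obtain ⟨b, hb, hle⟩ := (hO _).1 hX ψ hψ
    obtain ⟨φ, hφ, rfl⟩ := Finset.mem_image.1 hb
    exact ⟨φ, hφ, hle⟩
  | step X Y ψ _ _ ih => exact ih

/-- The outcome of the activation step is determined by its input. -/
theorem Activation.unique {Y' : Finset P} (h : Activation O rad X Y) (h' : Activation O rad X Y') :
    Y = Y' := by
  induction h with
  | done X hX =>
    cases h' with
    | done _ _ => rfl
    | step _ _ ψ hψ _ => rw [hX] at hψ; cases hψ
  | step X Y ψ hψ _ ih =>
    cases h' with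
    | done _ hX => rw [hX] at hψ; cases hψ
    | step _ _ ψ' hψ' h'' =>
      rw [hψ] at hψ'
      cases hψ'
      exact ih h''

/-- A symmetric relation that holds between a policy and the centre of a ball that does not cover it
holds between any two activated policies: the one activated later was not covered by the ball around
the other. -/
theorem Activation.pairwise (h : Activation O rad X Y) (hO : IsCoveringOracle Φ ρP O)
    {Sep : P → P → Prop} (hSep : ∀ φ ψ, Sep φ ψ → Sep ψ φ)
    (hrad : ∀ φ ψ, ¬ ρP ψ φ ≤ ENNReal.ofReal (rad φ) → Sep φ ψ)
    (hX : (X : Set P).Pairwise Sep) : (Y : Set P).Pairwise Sep := by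
  classical
  induction h with
  | done X _ => exact hX
  | step X Y ψ hψ _ ih =>
    refine ih ?_
    rw [Finset.coe_insert, Set.pairwise_insert]
    refine ⟨hX, fun φ hφ _ => ?_⟩
    have := hrad φ ψ (((hO _).2 ψ hψ).2 (φ, rad φ) (Finset.mem_image_of_mem _ hφ))
    exact ⟨hSep _ _ this, this⟩

end Active

section Run

variable {S A : Type*} [MeasurableSpace S] [MeasurableSpace A] {M : MDP S A}
  {O : Finset (Policy S A × ℝ) → Option (Policy S A)} {C α LJ cd δ : ℝ} {T : ℕ} {s : ℕ → S}
  {π : ℕ → Policy S A} {act : ℕ → Finset (Policy S A)} {Φ : Set (Policy S A)}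
  {ρΦ : Policy S A → Policy S A → ℝ≥0∞}

theorem IsRun.prevActive_subset (h : IsRun M O C α LJ cd δ T s π act) {t : ℕ} (ht : t < T) :
    prevActive act t ⊆ act t := (h.activate t ht).subset

theorem IsRun.mem_act (h : IsRun M O C α LJ cd δ T s π act) {t : ℕ} (ht : t < T) :
    π t ∈ act t := by
  induction t with
  | zero => exact (h.choose 0 ht (by simp [NewEpisode, episodeState])).1
  | succ t ih =>
    by_cases hnew : NewEpisode π (t + 1)
    · exact (h.choose _ ht hnew).1
    · rw [h.keep t ht hnew]
      exact h.prevActive_subset ht (ih (by lia))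

theorem IsRun.act_mono (h : IsRun M O C α LJ cd δ T s π act) {t u : ℕ} (htu : t ≤ u)
    (hu : u < T) : act t ⊆ act u := by
  induction u, htu using Nat.le_induction with
  | base => exact subset_rfl
  | succ u _ ih => exact (ih (by lia)).trans (h.prevActive_subset hu)

theorem IsRun.act_subset (h : IsRun M O C α LJ cd δ T s π act) (hO : IsCoveringOracle Φ ρΦ O)
    {t : ℕ} (ht : t < T) : (act t : Set (Policy S A)) ⊆ Φ := by
  induction t with
  | zero => exact (h.activate 0 ht).subset_class hO (by simp [prevActive])
  | succ t ih => exact (h.activate _ ht).subset_class hO (ih (by lia))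

theorem IsRun.act_pairwise (h : IsRun M O C α LJ cd δ T s π act) (hO : IsCoveringOracle Φ ρΦ O)
    {Sep : Policy S A → Policy S A → Prop} (hSep : ∀ φ ψ, Sep φ ψ → Sep ψ φ)
    (hrad : ∀ t < T, ∀ φ ψ, ¬ ρΦ ψ φ ≤ ENNReal.ofReal (policyDiam C α cd δ T π t φ) → Sep φ ψ)
    {t : ℕ} (ht : t < T) : (act t : Set (Policy S A)).Pairwise Sep := by
  induction t with
  | zero => exact (h.activate 0 ht).pairwise hO hSep (hrad 0 ht) (by simp [prevActive])
  | succ t ih => exact (h.activate _ ht).pairwise hO hSep (hrad _ ht) (ih (by lia))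

end Run

/-! ### Finitely many histories -/

section History

variable {S A Ω : Type*} [MeasurableSpace S] [MeasurableSpace A] {M : MDP S A}
  {O : Finset (Policy S A × ℝ) → Option (Policy S A)} {C α LJ cd δ : ℝ} {T : ℕ} {s : ℕ → Ω → S}
  {π : ℕ → Ω → Policy S A} {act : ℕ → Ω → Finset (Policy S A)}

/-- The oracle is deterministic, so that the active set is a function of the policies played
before. As these are active, the tree of all histories of played policies is finite. -/
theorem exists_finite_histories
    (h : ∀ ω, IsRun M O C α LJ cd δ T (fun t => s t ω) (fun t => π t ω) (fun t => act t ω))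
    {t : ℕ} (ht : t ≤ T) :
    ∃ F : Set ((ℕ → Policy S A) × Finset (Policy S A)), F.Finite ∧
      ∀ ω, ∃ x ∈ F, (∀ i < t, x.1 i = π i ω) ∧ x.2 = prevActive (fun t => act t ω) t := by
  classical
  induction t with
  | zero =>
    rcases isEmpty_or_nonempty Ω with hΩ | ⟨⟨ω₀⟩⟩
    · exact ⟨∅, Set.finite_empty, fun ω => hΩ.elim ω⟩
    · exact ⟨{(fun t => π t ω₀, ∅)}, Set.finite_singleton _, fun ω =>
        ⟨_, rfl, fun i hi => absurd hi (Nat.not_lt_zero i), rfl⟩⟩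
  | succ t ih =>
    obtain ⟨F, hF, hFω⟩ := ih (by lia)
    have hY : ∃ Y : (ℕ → Policy S A) × Finset (Policy S A) → Finset (Policy S A),
        ∀ x Z, Activation O (policyDiam C α cd δ T x.1 t) x.2 Z → Z = Y x := by
      choose! Y hY using fun x : (ℕ → Policy S A) × Finset (Policy S A) =>
        show (∃ Z, Activation O (policyDiam C α cd δ T x.1 t) x.2 Z) →
          ∃ Z, Activation O (policyDiam C α cd δ T x.1 t) x.2 Z from id
      exact ⟨Y, fun x Z hZ => hZ.unique (hY x ⟨Z, hZ⟩)⟩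
    obtain ⟨Y, hY⟩ := hY
    refine ⟨⋃ x ∈ F, (fun φ => (Function.update x.1 t φ, Y x)) '' (Y x : Set (Policy S A)),
      hF.biUnion fun x _ => (Y x).finite_toSet.image _, fun ω => ?_⟩
    obtain ⟨x, hx, hπ, hact⟩ := hFω ω
    have hYω : act t ω = Y x := by
      refine hY x _ ?_
      rw [policyDiam_congr C α cd δ T hπ, hact]
      exact (h ω).activate t ht
    refine ⟨(Function.update x.1 t (π t ω), Y x), ?_, ?_, ?_⟩
    · refine Set.mem_biUnion hx ⟨π t ω, ?_, rfl⟩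
      rw [← hYω]
      exact (h ω).mem_act ht
    · intro i hi
      by_cases hit : i = t
      · subst hit; simp
      · refine (Function.update_of_ne hit _ _).trans ?_
        exact hπ i (by lia)
    · exact hYω.symm

theorem finite_range_policy
    (h : ∀ ω, IsRun M O C α LJ cd δ T (fun t => s t ω) (fun t => π t ω) (fun t => act t ω))
    {t : ℕ} (ht : t < T) : (Set.range (π t)).Finite := by
  obtain ⟨F, hF, hFω⟩ := exists_finite_histories h (t := t + 1) ht
  refine (hF.image fun x => x.1 t).subset ?_
  rintro _ ⟨ω, rfl⟩
  obtain ⟨x, hx, hπ, -⟩ := hFω ω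
  exact ⟨x, hx, hπ t t.lt_succ_self⟩

end History

/-! ### Exponential inequalities for one transition -/

section Transition

variable {S A Ω : Type*} [MeasurableSpace S] [MeasurableSpace A] [mΩ : MeasurableSpace Ω]
  {P : Measure Ω} {M : MDP S A} {μ₀ : Measure S} {O : Finset (Policy S A × ℝ) → Option (Policy S A)}
  {C α LJ cd δ : ℝ} {T : ℕ} {ℱ : Filtration ℕ mΩ} {s : ℕ → Ω → S} {π : ℕ → Ω → Policy S A}
  {act : ℕ → Ω → Finset (Policy S A)} {t : ℕ} {φ : Policy S A} {W : Set Ω}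

theorem IsProcess.measurable_state (h : IsProcess P M μ₀ O C α LJ cd δ T ℱ s π act) (ht : t < T) :
    Measurable (s t) := (h.adapted_state t ht).mono (ℱ.le t) le_rfl

/-- The transition property for weights that are measurable with respect to the past. -/
theorem IsProcess.setLIntegral_preimage [IsFiniteMeasure P]
    (h : IsProcess P M μ₀ O C α LJ cd δ T ℱ s π act) (ht : t + 1 < T)
    (hW : MeasurableSet[ℱ t] W) (hWφ : ∀ ω ∈ W, π t ω = φ) {Z : Ω → ℝ≥0∞}
    (hZ : Measurable[ℱ t] Z) {B : Set S} (hB : MeasurableSet B) :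
    ∫⁻ ω in W ∩ s (t + 1) ⁻¹' B, Z ω ∂P =
      ∫⁻ ω in W, Z ω * chainKernel M φ (s t ω) B ∂P := by
  have hs := h.measurable_state (t := t) (by lia)
  have hκ : Measurable fun ω => chainKernel M φ (s t ω) B :=
    ((chainKernel M φ).measurable_coe hB).comp hs
  have hW' := ℱ.le t _ hW
  have hXB := h.measurable_state ht hB
  have key : (P.restrict (W ∩ s (t + 1) ⁻¹' B)).trim (ℱ.le t) =
      ((P.restrict W).withDensity fun ω => chainKernel M φ (s t ω) B).trim (ℱ.le t) := by
    refine @Measure.ext _ (ℱ t) _ _ fun E hE => ?_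
    have hE' := ℱ.le t _ hE
    rw [trim_measurableSet_eq _ hE, trim_measurableSet_eq _ hE, Measure.restrict_apply hE',
      withDensity_apply _ hE', Measure.restrict_restrict hE', ← Set.inter_assoc,
      h.transition t ht (E ∩ W) (hE.inter hW) B hB]
    refine setLIntegral_congr_fun (hE'.inter hW') fun ω hω => ?_
    simp only [hWφ ω hω.2]
    rfl
  rw [← lintegral_trim (ℱ.le t) hZ, key, lintegral_trim (ℱ.le t) hZ,
    lintegral_withDensity_eq_lintegral_mul _ hκ (hZ.mono (ℱ.le t) le_rfl)]
  simp only [Pi.mul_apply, mul_comm]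

theorem IsProcess.setLIntegral_transition [IsFiniteMeasure P]
    (h : IsProcess P M μ₀ O C α LJ cd δ T ℱ s π act) (ht : t + 1 < T)
    (hW : MeasurableSet[ℱ t] W) (hWφ : ∀ ω ∈ W, π t ω = φ) {Z : Ω → ℝ≥0∞}
    (hZ : Measurable[ℱ t] Z) (hZfin : ∫⁻ ω, Z ω ∂P ≠ ∞) {g : S × S → ℝ≥0∞} (hg : Measurable g) :
    ∫⁻ ω in W, Z ω * g (s t ω, s (t + 1) ω) ∂P =
      ∫⁻ ω in W, Z ω * ∫⁻ y, g (s t ω, y) ∂(chainKernel M φ (s t ω)) ∂P := by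
  have hs := h.measurable_state (t := t) (by lia)
  have hs' := h.measurable_state ht
  have hZ' : Measurable Z := hZ.mono (ℱ.le t) le_rfl
  have hW' := ℱ.le t _ hW
  have hfin : IsFiniteMeasure ((P.restrict W).withDensity Z) :=
    isFiniteMeasure_withDensity
      (ne_top_of_le_ne_top hZfin (lintegral_mono' Measure.restrict_le_self le_rfl))
  have wd : ∀ {ν : Measure Ω} {f : Ω → ℝ≥0∞}, Measurable f →
      ∫⁻ ω, f ω ∂(ν.withDensity Z) = ∫⁻ ω, Z ω * f ω ∂ν := fun hf =>
    lintegral_withDensity_eq_lintegral_mul _ hZ' hf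
  set η := (P.restrict W).withDensity Z with hη
  have e : η.map (fun ω => (s t ω, s (t + 1) ω)) = (η.map (s t)).compProd (chainKernel M φ) := by
    refine Measure.ext_prod fun {E B} hE hB => ?_
    have hset : MeasurableSet (s t ⁻¹' E ∩ s (t + 1) ⁻¹' B) := (hs hE).inter (hs' hB)
    rw [Measure.map_apply (hs.prodMk hs') (hE.prod hB), Measure.compProd_apply_prod hE hB,
      setLIntegral_map hE ((chainKernel M φ).measurable_coe hB) hs]
    have e1 : (fun ω => (s t ω, s (t + 1) ω)) ⁻¹' (E ×ˢ B) = s t ⁻¹' E ∩ s (t + 1) ⁻¹' B := by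
      ext ω; simp
    have hEt : MeasurableSet[ℱ t] (s t ⁻¹' E) := h.adapted_state t (by lia) hE
    have hκ : Measurable fun ω => chainKernel M φ (s t ω) B :=
      ((chainKernel M φ).measurable_coe hB).comp hs
    rw [e1, hη, withDensity_apply _ hset, restrict_withDensity (hs hE), wd hκ,
      Measure.restrict_restrict hset, Measure.restrict_restrict (hs hE)]
    have := h.setLIntegral_preimage ht (hEt.inter hW) (fun ω hω => hWφ ω hω.2) hZ hB
    rw [show s t ⁻¹' E ∩ s (t + 1) ⁻¹' B ∩ W = s t ⁻¹' E ∩ W ∩ s (t + 1) ⁻¹' B by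
      ext; simp; tauto]
    exact this
  have hg1 : Measurable fun ω => g (s t ω, s (t + 1) ω) := hg.comp (hs.prodMk hs')
  have hg2 : Measurable fun ω => ∫⁻ y, g (s t ω, y) ∂(chainKernel M φ (s t ω)) :=
    hg.lintegral_kernel_prod_right'.comp hs
  rw [← wd hg1, ← wd hg2, ← hη, ← lintegral_map hg (hs.prodMk hs'), e,
    Measure.lintegral_compProd hg, lintegral_map hg.lintegral_kernel_prod_right' hs]

/-- Hoeffding's lemma in normalized form. -/
theorem lintegral_exp_le_one {X : Type*} [MeasurableSpace X] (κ : Measure X)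
    [IsProbabilityMeasure κ] {f : X → ℝ} (hf : Measurable f) {b : ℝ} (hb : ∀ x, |f x| ≤ b)
    (l : ℝ) :
    ∫⁻ y, ENNReal.ofReal (Real.exp (l * (f y - ∫ y, f y ∂κ) - l ^ 2 * b ^ 2 / 2)) ∂κ ≤ 1 := by
  have hsub := hasSubgaussianMGF_of_mem_Icc (μ := κ) (X := f) (a := -b) (b := b) hf.aemeasurable
    (Eventually.of_forall fun x => ⟨(abs_le.1 (hb x)).1, (abs_le.1 (hb x)).2⟩)
  have hmgf := hsub.mgf_le l
  have hint := (hsub.integrable_exp_mul l)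
  have e : ∀ y, Real.exp (l * (f y - ∫ y, f y ∂κ) - l ^ 2 * b ^ 2 / 2) =
      Real.exp (l * (f y - ∫ y, f y ∂κ)) * Real.exp (-(l ^ 2 * b ^ 2 / 2)) := by
    intro y; rw [← Real.exp_add]; ring_nf
  simp only [e]
  rw [← ofReal_integral_eq_lintegral_ofReal (hint.mul_const _)
    (Eventually.of_forall fun y => by positivity), integral_mul_const]
  refine ENNReal.ofReal_le_one.2 ?_
  have hcoef : ((((‖b - -b‖₊ / 2) ^ 2 : NNReal) : ℝ)) = b ^ 2 := by
    push_cast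
    rw [Real.norm_eq_abs, div_pow, sq_abs]; ring
  rw [hcoef] at hmgf
  calc _ ≤ Real.exp (b ^ 2 * l ^ 2 / 2) * Real.exp (-(l ^ 2 * b ^ 2 / 2)) :=
        mul_le_mul_of_nonneg_right hmgf (Real.exp_pos _).le
    _ = 1 := by rw [← Real.exp_add]; ring_nf; simp

/-- Hoeffding's lemma for the deviation of a bounded function of the next state from its
conditional expectation. -/
theorem IsProcess.setLIntegral_exp_le [IsFiniteMeasure P]
    (h : IsProcess P M μ₀ O C α LJ cd δ T ℱ s π act) (ht : t + 1 < T)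
    (hW : MeasurableSet[ℱ t] W) (hWφ : ∀ ω ∈ W, π t ω = φ) {Z : Ω → ℝ≥0∞}
    (hZ : Measurable[ℱ t] Z) (hZfin : ∫⁻ ω, Z ω ∂P ≠ ∞) {f : S → ℝ} (hf : Measurable f) {b : ℝ}
    (hb : ∀ x, |f x| ≤ b) (l : ℝ) :
    ∫⁻ ω in W, Z ω * ENNReal.ofReal (Real.exp
      (l * (f (s (t + 1) ω) - ∫ y, f y ∂(chainKernel M φ (s t ω))) - l ^ 2 * b ^ 2 / 2)) ∂P ≤
      ∫⁻ ω in W, Z ω ∂P := by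
  have hPf := measurable_integral_chainKernel M φ hf
  have hg : Measurable fun x : S × S => ENNReal.ofReal (Real.exp
      (l * (f x.2 - ∫ y, f y ∂(chainKernel M φ x.1)) - l ^ 2 * b ^ 2 / 2)) := by
    have h1 : Measurable fun x : S × S => ∫ y, f y ∂(chainKernel M φ x.1) :=
      hPf.comp measurable_fst
    fun_prop
  rw [h.setLIntegral_transition ht hW hWφ hZ hZfin hg]
  refine lintegral_mono fun ω => ?_
  conv_rhs => rw [← mul_one (Z ω)]
  refine mul_le_mul_right ?_ _
  exact lintegral_exp_le_one _ hf hb l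

end Transition

/-! ### Concentration along the plays of one policy -/

section Concentration

variable {S A Ω : Type*} [MeasurableSpace S] [MeasurableSpace A] [mΩ : MeasurableSpace Ω]
  {P : Measure Ω} {M : MDP S A} {μ₀ : Measure S} {O : Finset (Policy S A × ℝ) → Option (Policy S A)}
  {C α LJ cd δ : ℝ} {T : ℕ} {ℱ : Filtration ℕ mΩ} {s : ℕ → Ω → S} {π : ℕ → Ω → Policy S A}
  {act : ℕ → Ω → Finset (Policy S A)} {φ : Policy S A}

open Classical in
/-- Along one trajectory, the sum of the deviations of `f` from its one-step predictions, over those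
of the first `n` plays of `φ` that happen at times in `[k, i)`. -/
def deviation (M : MDP S A) (φ : Policy S A) (f : S → ℝ) (s : ℕ → S) (π : ℕ → Policy S A)
    (n k i : ℕ) : ℝ :=
  ∑ j ∈ Finset.Ico k i, if π j = φ ∧ playCount π j φ < n then
    f (s (j + 1)) - ∫ y, f y ∂(chainKernel M φ (s j)) else 0

open Classical in
/-- Number of plays of `φ` at times in `[k, i)` that are among its first `n` plays. -/
def truncatedCount {P : Type*} (π : ℕ → P) (φ : P) (n k i : ℕ) : ℕ :=
  ∑ j ∈ Finset.Ico k i, if π j = φ ∧ playCount π j φ < n then 1 else 0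

theorem truncatedCount_zero {P : Type*} (π : ℕ → P) (φ : P) (n i : ℕ) :
    truncatedCount π φ n 0 i = min n (playCount π i φ) := by
  classical
  induction i with
  | zero => simp [playCount, truncatedCount]
  | succ i ih =>
    unfold truncatedCount at ih ⊢
    rw [Finset.sum_Ico_succ_top (Nat.zero_le i), ih, playCount_succ]
    split_ifs with h1 h2 h3 <;> lia

theorem truncatedCount_le {P : Type*} (π : ℕ → P) (φ : P) (n k i : ℕ) :
    truncatedCount π φ n k i ≤ n := by
  refine le_trans (Finset.sum_le_sum_of_subset
    (Finset.Ico_subset_Ico_left (Nat.zero_le k))) ((truncatedCount_zero π φ n i).trans_le ?_)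
  exact min_le_left _ _

theorem IsProcess.measurable_playCount (h : IsProcess P M μ₀ O C α LJ cd δ T ℱ s π act)
    (φ : Policy S A) {i : ℕ} (hi : i < T) {j : ℕ} (hj : j ≤ i) :
    Measurable[ℱ i] fun ω => playCount (fun t => π t ω) j φ := by
  classical
  induction j with
  | zero => simp only [playCount, Finset.range_zero, Finset.filter_empty, Finset.card_empty]
            exact measurable_const
  | succ j ih =>
    simp only [playCount_succ]
    refine Measurable.add (ih (by lia)) (Measurable.ite ?_ measurable_const measurable_const)
    exact ℱ.mono (by lia : j ≤ i) _ (h.adapted_policy j (by lia) φ)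

theorem IsProcess.measurableSet_truncated_play (h : IsProcess P M μ₀ O C α LJ cd δ T ℱ s π act)
    (φ : Policy S A) (n : ℕ) {i : ℕ} (hi : i < T) :
    MeasurableSet[ℱ i] {ω | π i ω = φ ∧ playCount (fun t => π t ω) i φ < n} :=
  (h.adapted_policy i hi φ).inter
    (h.measurable_playCount φ hi le_rfl (measurableSet_Iio (a := n)))

open Classical in
/-- The exponential supermartingale of the deviations, restricted to the event that `φ` is played
at time `k`. -/
def expWeight (M : MDP S A) (φ : Policy S A) (f : S → ℝ) (b l : ℝ) (s : ℕ → Ω → S)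
    (π : ℕ → Ω → Policy S A) (n k i : ℕ) (ω : Ω) : ℝ≥0∞ :=
  (if π k ω = φ then 1 else 0) * ∏ j ∈ Finset.Ico k i,
    if π j ω = φ ∧ playCount (fun t => π t ω) j φ < n then
      ENNReal.ofReal (Real.exp
        (l * (f (s (j + 1) ω) - ∫ y, f y ∂(chainKernel M φ (s j ω))) - l ^ 2 * b ^ 2 / 2))
    else 1

theorem IsProcess.measurable_expWeight (h : IsProcess P M μ₀ O C α LJ cd δ T ℱ s π act)
    {f : S → ℝ} (hf : Measurable f) (b l : ℝ) (n : ℕ) {k i : ℕ} (hki : k ≤ i) (hi : i < T) :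
    Measurable[ℱ i] (expWeight M φ f b l s π n k i) := by
  refine Measurable.mul (Measurable.ite (ℱ.mono hki _ (h.adapted_policy k (by lia) φ))
    measurable_const measurable_const) ?_
  refine Finset.measurable_fun_prod _ fun j hj => ?_
  have hj := Finset.mem_Ico.1 hj
  refine Measurable.ite (ℱ.mono (by lia : j ≤ i) _
    (h.measurableSet_truncated_play φ n (by lia))) ?_ measurable_const
  have h1 : Measurable[ℱ i] fun ω => f (s (j + 1) ω) :=
    hf.comp ((h.adapted_state (j + 1) (by lia)).mono (ℱ.mono (by lia)) le_rfl)
  have h2 : Measurable[ℱ i] fun ω => ∫ y, f y ∂(chainKernel M φ (s j ω)) :=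
    (measurable_integral_chainKernel M φ hf).comp
      ((h.adapted_state j (by lia)).mono (ℱ.mono (by lia)) le_rfl)
  exact (Real.measurable_exp.comp (((h1.sub h2).const_mul l).sub_const _)).ennreal_ofReal

theorem IsProcess.lintegral_expWeight_le [IsFiniteMeasure P]
    (h : IsProcess P M μ₀ O C α LJ cd δ T ℱ s π act)
    {f : S → ℝ} (hf : Measurable f) {b : ℝ} (hb : ∀ x, |f x| ≤ b) (l : ℝ) (n : ℕ) {k i : ℕ}
    (hki : k ≤ i) (hi : i < T) :
    ∫⁻ ω, expWeight M φ f b l s π n k i ω ∂P ≤ P {ω | π k ω = φ} := by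
  classical
  induction i, hki using Nat.le_induction with
  | base =>
    have hE := ℱ.le k _ (h.adapted_policy k hi φ)
    rw [← lintegral_indicator_one hE]
    refine lintegral_mono fun ω => ?_
    simp [expWeight, Set.indicator_apply]
  | succ i hki ih =>
    refine le_trans ?_ (ih (by lia))
    set W := {ω | π i ω = φ ∧ playCount (fun t => π t ω) i φ < n}
    have hW : MeasurableSet[ℱ i] W := h.measurableSet_truncated_play φ n (by lia)
    have hW' := ℱ.le i _ hW
    have hsucc : ∀ ω, expWeight M φ f b l s π n k (i + 1) ω = expWeight M φ f b l s π n k i ω *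
        if ω ∈ W then ENNReal.ofReal (Real.exp (l * (f (s (i + 1) ω) -
          ∫ y, f y ∂(chainKernel M φ (s i ω))) - l ^ 2 * b ^ 2 / 2)) else 1 := by
      intro ω
      unfold expWeight
      rw [Finset.prod_Ico_succ_top hki, mul_assoc]
      rfl
    have hm := h.measurable_expWeight (φ := φ) hf b l n hki (by lia)
    rw [← lintegral_add_compl _ hW', ← lintegral_add_compl (expWeight M φ f b l s π n k i) hW']
    refine add_le_add ?_ (le_of_eq ?_)
    · refine le_trans (le_of_eq ?_) (h.setLIntegral_exp_le hi hW (fun ω hω => hω.1) hm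
        (ne_top_of_le_ne_top (measure_ne_top _ _) (ih (by lia))) hf hb l)
      refine setLIntegral_congr_fun hW' fun ω hω => ?_
      simp only [hsucc, if_pos hω]
    · refine setLIntegral_congr_fun hW'.compl fun ω hω => ?_
      simp only [hsucc, if_neg hω, mul_one]

/-- The Chernoff bound: on the event that `φ` is played at time `k`, the deviations over the first
`n` plays are large in the direction of `l` only with small probability. -/
theorem IsProcess.measure_deviation_le [IsFiniteMeasure P]
    (h : IsProcess P M μ₀ O C α LJ cd δ T ℱ s π act)
    {f : S → ℝ} (hf : Measurable f) {b : ℝ} (hb : ∀ x, |f x| ≤ b) (l : ℝ) (n : ℕ) {k i : ℕ}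
    (hki : k ≤ i) (hi : i < T) :
    P {ω | π k ω = φ ∧ l ^ 2 * b ^ 2 * n ≤
        l * deviation M φ f (fun t => s t ω) (fun t => π t ω) n k i} ≤
      P {ω | π k ω = φ} * ENNReal.ofReal (Real.exp (-(l ^ 2 * b ^ 2 * n / 2))) := by
  classical
  set a := l ^ 2 * b ^ 2 * n / 2 with ha
  have hsub : {ω | π k ω = φ ∧ l ^ 2 * b ^ 2 * n ≤
        l * deviation M φ f (fun t => s t ω) (fun t => π t ω) n k i} ⊆
      {ω | ENNReal.ofReal (Real.exp a) ≤ expWeight M φ f b l s π n k i ω} := by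
    rintro ω ⟨hk, hω⟩
    have hcount : (truncatedCount (fun t => π t ω) φ n k i : ℝ) ≤ n :=
      Nat.cast_le.2 (truncatedCount_le (fun t => π t ω) φ n k i)
    have e : expWeight M φ f b l s π n k i ω = ENNReal.ofReal (Real.exp
        (l * deviation M φ f (fun t => s t ω) (fun t => π t ω) n k i - l ^ 2 * b ^ 2 / 2 *
          (truncatedCount (fun t => π t ω) φ n k i : ℝ))) := by
      unfold expWeight deviation truncatedCount
      rw [if_pos hk, one_mul, Nat.cast_sum, Finset.mul_sum, Finset.mul_sum,
        ← Finset.sum_sub_distrib, Real.exp_sum,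
        ENNReal.ofReal_prod_of_nonneg fun j _ => (Real.exp_pos _).le]
      refine Finset.prod_congr rfl fun j _ => ?_
      split_ifs <;> simp
    rw [Set.mem_ofPred_eq, e]
    refine ENNReal.ofReal_le_ofReal (Real.exp_le_exp.2 ?_)
    nlinarith [mul_le_mul_of_nonneg_left hcount (by positivity : 0 ≤ l ^ 2 * b ^ 2 / 2)]
  have hm := (h.measurable_expWeight (φ := φ) hf b l n hki hi).mono (ℱ.le i) le_rfl
  have h1 := (mul_meas_ge_le_lintegral (μ := P) hm (ENNReal.ofReal (Real.exp a))).trans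
    (h.lintegral_expWeight_le hf hb l n hki hi)
  have h2 : ENNReal.ofReal (Real.exp (-a)) * ENNReal.ofReal (Real.exp a) = 1 := by
    rw [← ENNReal.ofReal_mul (Real.exp_pos _).le, ← Real.exp_add]; simp
  calc _ ≤ P {ω | ENNReal.ofReal (Real.exp a) ≤ expWeight M φ f b l s π n k i ω} :=
        measure_mono hsub
    _ = ENNReal.ofReal (Real.exp (-a)) * (ENNReal.ofReal (Real.exp a) *
          P {ω | ENNReal.ofReal (Real.exp a) ≤ expWeight M φ f b l s π n k i ω}) := by
        rw [← mul_assoc, h2, one_mul]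
    _ ≤ _ := by rw [mul_comm]; exact mul_le_mul_left h1 _

/-- Two-sided bound over all policies: as `π k` has finitely many values, the bounds on the events
`π k = φ` can be added, and there is no loss in the number of policies. -/
theorem IsProcess.measure_abs_deviation_le [IsProbabilityMeasure P]
    (h : IsProcess P M μ₀ O C α LJ cd δ T ℱ s π act)
    {f : Policy S A → S → ℝ} (hf : ∀ φ, Measurable (f φ)) {b : ℝ} (hb0 : 0 < b)
    {k i n : ℕ} (hki : k ≤ i) (hi : i < T) (hb : ∀ ω x, |f (π k ω) x| ≤ b) (hn : 0 < n)
    {x : ℝ} (hx : 0 ≤ x) :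
    P {ω | 2 * b * √(x * n) ≤
        |deviation M (π k ω) (f (π k ω)) (fun t => s t ω) (fun t => π t ω) n k i|} ≤
      ENNReal.ofReal (2 * Real.exp (-(2 * x))) := by
  classical
  have hfin := finite_range_policy h.run (t := k) (by lia)
  set F := hfin.toFinset with hF
  have hn' : (0 : ℝ) < n := Nat.cast_pos.2 hn
  -- the slope that optimizes the Chernoff bound at the threshold `2 * b * √(x * n)`
  set l : ℝ := 2 * √(x * n) / (n * b) with hl
  have hsq : √(x * n) ^ 2 = x * n := Real.sq_sqrt (by positivity)
  have hl2 : l ^ 2 * b ^ 2 * n = 4 * x := by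
    rw [hl, div_pow, mul_pow, hsq]; field_simp; ring
  have hlx : l * (2 * b * √(x * n)) = 4 * x := by
    have : l * (2 * b * √(x * n)) = 4 * √(x * n) ^ 2 / n := by rw [hl]; field_simp; ring
    rw [this, hsq]; field_simp
  have hl0 : 0 ≤ l := by positivity
  set dev := fun (φ : Policy S A) ω =>
    deviation M φ (f φ) (fun t => s t ω) (fun t => π t ω) n k i
  have hsub : {ω | 2 * b * √(x * n) ≤ |dev (π k ω) ω|} ⊆
      ⋃ φ ∈ F, ({ω | π k ω = φ ∧ l ^ 2 * b ^ 2 * n ≤ l * dev φ ω} ∪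
        {ω | π k ω = φ ∧ (-l) ^ 2 * b ^ 2 * n ≤ -l * dev φ ω}) := by
    intro ω hω
    refine Set.mem_biUnion (x := π k ω) (by simp [hF]) ?_
    rw [Set.mem_ofPred_eq, le_abs] at hω
    rcases hω with hω | hω
    · refine Or.inl ⟨rfl, ?_⟩
      rw [hl2, ← hlx]
      exact mul_le_mul_of_nonneg_left hω hl0
    · refine Or.inr ⟨rfl, ?_⟩
      rw [neg_sq, hl2, ← hlx, neg_mul, ← mul_neg]
      exact mul_le_mul_of_nonneg_left hω hl0
  have hone : ∀ φ ∈ F, P ({ω | π k ω = φ ∧ l ^ 2 * b ^ 2 * n ≤ l * dev φ ω} ∪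
        {ω | π k ω = φ ∧ (-l) ^ 2 * b ^ 2 * n ≤ -l * dev φ ω}) ≤
      P {ω | π k ω = φ} * ENNReal.ofReal (2 * Real.exp (-(2 * x))) := by
    intro φ hφ
    obtain ⟨ω₀, rfl⟩ := hfin.mem_toFinset.1 hφ
    have h1 := h.measure_deviation_le (φ := π k ω₀) (hf _) (hb ω₀) l n hki hi
    have h2 := h.measure_deviation_le (φ := π k ω₀) (hf _) (hb ω₀) (-l) n hki hi
    have e : l ^ 2 * b ^ 2 * n / 2 = 2 * x := by rw [hl2]; ring
    rw [e] at h1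
    rw [neg_sq, e] at h2
    rw [two_mul, ENNReal.ofReal_add (Real.exp_pos _).le (Real.exp_pos _).le, mul_add]
    refine (measure_union_le _ _).trans (add_le_add h1 ?_)
    rw [neg_sq]
    exact h2
  have hdisj : ∑ φ ∈ F, P {ω | π k ω = φ} ≤ 1 := by
    rw [← measure_biUnion_finset]
    · exact prob_le_one
    · intro φ _ ψ _ hne
      exact Set.disjoint_left.2 fun ω h1 h2 => hne (Eq.trans (Eq.symm h1) h2)
    · exact fun φ _ => ℱ.le k _ (h.adapted_policy k (by lia) φ)
  calc _ ≤ ∑ φ ∈ F, P ({ω | π k ω = φ ∧ l ^ 2 * b ^ 2 * n ≤ l * dev φ ω} ∪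
        {ω | π k ω = φ ∧ (-l) ^ 2 * b ^ 2 * n ≤ -l * dev φ ω}) :=
        (measure_mono hsub).trans (measure_biUnion_finset_le _ _)
    _ ≤ ∑ φ ∈ F, P {ω | π k ω = φ} * ENNReal.ofReal (2 * Real.exp (-(2 * x))) :=
        Finset.sum_le_sum hone
    _ ≤ 1 * ENNReal.ofReal (2 * Real.exp (-(2 * x))) := by
        rw [← Finset.sum_mul]; exact mul_le_mul_left hdisj _
    _ = _ := one_mul _

end Concentration

/-! ### The clean event -/

section Path

variable {S A : Type*} [MeasurableSpace S] [MeasurableSpace A] {M : MDP S A}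
  {s : ℕ → S} {π : ℕ → Policy S A} {φ : Policy S A} {T t : ℕ}

open Classical in
/-- The sum of all deviations over the plays of `φ` before time `t`, as one of the truncated sums
that are controlled by concentration: start at the first play and stop at the last play counted. -/
theorem deviation_eq_sum (f : S → ℝ) {k i : ℕ} (hk : ∀ j, π j = φ → k ≤ j) (hti : t ≤ i) :
    deviation M φ f s π (playCount π t φ) k i =
      ∑ j ∈ Finset.range t, if π j = φ then
        f (s (j + 1)) - ∫ y, f y ∂(chainKernel M φ (s j)) else 0 := by
  unfold deviation
  rw [← Finset.sum_filter, ← Finset.sum_filter]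
  refine Finset.sum_congr ?_ fun _ _ => rfl
  ext j
  simp only [Finset.mem_filter, Finset.mem_Ico, Finset.mem_range]
  constructor
  · rintro ⟨_, hj, hlt⟩
    refine ⟨?_, hj⟩
    by_contra! hle
    exact absurd (playCount_mono π φ hle) (not_le.2 hlt)
  · rintro ⟨hjt, hj⟩
    refine ⟨⟨hk j hj, by lia⟩, hj, ?_⟩
    have h1 : playCount π (j + 1) φ ≤ playCount π t φ := playCount_mono π φ hjt
    rw [playCount_succ, if_pos hj] at h1
    lia

open Classical in
/-- Differences of a bounded function at consecutive states telescope within an episode, so that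
only the number of episodes matters. -/
theorem abs_sum_telescope_le
    (hkeep : ∀ t, t + 1 < T → ¬ NewEpisode π (t + 1) → π (t + 1) = π t) (ht : t ≤ T) {f : S → ℝ}
    {b : ℝ} (hb : ∀ x, |f x| ≤ b) :
    |∑ j ∈ Finset.range t, if π j = φ then f (s j) - f (s (j + 1)) else 0| ≤
      2 * b * episodeCount π t φ := by
  -- during an episode of `φ` the current state is still to be accounted for
  have key : ∀ u < T, (π u = φ →
      |(∑ j ∈ Finset.range (u + 1), if π j = φ then f (s j) - f (s (j + 1)) else 0) +
        f (s (u + 1))| ≤ 2 * b * episodeCount π (u + 1) φ - b) ∧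
      |∑ j ∈ Finset.range (u + 1), if π j = φ then f (s j) - f (s (j + 1)) else 0| ≤
        2 * b * episodeCount π (u + 1) φ := by
    have close : ∀ (a c : ℝ) (x : S), |a + f x| ≤ c - b → |a| ≤ c := fun a c x h => by
      have := abs_sub (a + f x) (f x)
      rw [add_sub_cancel_right] at this
      linarith [hb x]
    have start : ∀ v, (π v = φ → NewEpisode π v) →
        |∑ j ∈ Finset.range v, if π j = φ then f (s j) - f (s (j + 1)) else 0| ≤
          2 * b * episodeCount π v φ →
        (π v = φ → |(∑ j ∈ Finset.range (v + 1), if π j = φ then f (s j) - f (s (j + 1)) else 0) +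
          f (s (v + 1))| ≤ 2 * b * episodeCount π (v + 1) φ - b) ∧
        |∑ j ∈ Finset.range (v + 1), if π j = φ then f (s j) - f (s (j + 1)) else 0| ≤
          2 * b * episodeCount π (v + 1) φ := by
      intro v hnew hle
      rw [Finset.sum_range_succ, episodeCount_succ]
      by_cases hv : π v = φ
      · have h1 : |(∑ j ∈ Finset.range v, if π j = φ then f (s j) - f (s (j + 1)) else 0) +
            (f (s v) - f (s (v + 1))) + f (s (v + 1))| ≤
            2 * b * (episodeCount π v φ + 1 : ℕ) - b := by
          rw [add_assoc, sub_add_cancel]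
          refine (abs_add_le _ _).trans ?_
          push_cast
          linarith [hb (s v)]
        rw [if_pos hv, if_pos ⟨hnew hv, hv⟩]
        exact ⟨fun _ => h1, close _ _ _ h1⟩
      · rw [if_neg hv, if_neg fun h => hv h.2, add_zero, add_zero]
        exact ⟨fun h => absurd h hv, hle⟩
    intro u hu
    induction u with
    | zero =>
      exact start 0 (fun _ => by simp [NewEpisode, episodeState]) (by simp [episodeCount])
    | succ u ih =>
      have ih := ih (by lia)
      by_cases hnew : NewEpisode π (u + 1)
      · exact start _ (fun _ => hnew) ih.2
      · by_cases hφ : π (u + 1) = φ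
        · have h1 := ih.1 ((hkeep u hu hnew).symm.trans hφ)
          rw [Finset.sum_range_succ, episodeCount_succ, if_pos hφ, if_neg fun h => hnew h.1,
            add_zero]
          have h2 : |(∑ j ∈ Finset.range (u + 1), if π j = φ then f (s j) - f (s (j + 1)) else 0) +
              (f (s (u + 1)) - f (s (u + 1 + 1))) + f (s (u + 1 + 1))| ≤
              2 * b * episodeCount π (u + 1) φ - b := by
            rw [add_assoc, sub_add_cancel]; exact h1
          exact ⟨fun _ => h2, close _ _ _ h2⟩
        · exact start _ (fun h => absurd h hφ) ih.2
  cases t with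
  | zero => simp [episodeCount]
  | succ u => exact (key u ht).2

open Classical in
/-- The rewards collected by `φ` deviate from their long-run value by the martingale part and by a
boundary term for each episode. -/
theorem abs_rewards_sub_le {C α : ℝ} {μ : ProbabilityMeasure S} (h : IsErgodicLimit M C α φ μ)
    (hC : 0 ≤ C) (hα : 0 ≤ α) (hα' : α < 1)
    (hkeep : ∀ t, t + 1 < T → ¬ NewEpisode π (t + 1) → π (t + 1) = π t) (ht : t ≤ T) {k i : ℕ}
    (hk : ∀ j, π j = φ → k ≤ j) (hti : t ≤ i) :
    |(∑ j ∈ Finset.range t, if π j = φ then M.r (s j, φ.1 (s j)) else 0) -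
        playCount π t φ * statReward M φ μ| ≤
      |deviation M φ (bias M φ μ) s π (playCount π t φ) k i| +
        C / (1 - α) * episodeCount π t φ := by
  have e : (∑ j ∈ Finset.range t, if π j = φ then M.r (s j, φ.1 (s j)) else 0) -
        playCount π t φ * statReward M φ μ =
      deviation M φ (bias M φ μ) s π (playCount π t φ) k i +
        ∑ j ∈ Finset.range t, if π j = φ then bias M φ μ (s j) - bias M φ μ (s (j + 1)) else 0 := by
    have hN : (playCount π t φ : ℝ) * statReward M φ μ =
        ∑ j ∈ Finset.range t, if π j = φ then statReward M φ μ else 0 := by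
      rw [playCount_eq_sum, Nat.cast_sum, Finset.sum_mul]
      exact Finset.sum_congr rfl fun j _ => by split_ifs <;> simp
    rw [deviation_eq_sum _ hk hti, hN, ← Finset.sum_sub_distrib, ← Finset.sum_add_distrib]
    refine Finset.sum_congr rfl fun j _ => ?_
    split_ifs
    · rw [← bias_sub_integral_bias h hC hα hα' (s j)]; ring
    · simp
  rw [e]
  refine (abs_add_le _ _).trans (add_le_add le_rfl ?_)
  have := abs_sum_telescope_le (s := s) (φ := φ) hkeep ht (abs_bias_le h hC hα hα')
  rwa [show 2 * (C / (2 * (1 - α))) = C / (1 - α) by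
    rw [← div_div, mul_div_assoc', mul_div_cancel₀ _ two_ne_zero]] at this

open Classical in
/-- Along this trajectory the rewards of each policy of the class are, at all times before the
horizon, as close to their long-run value as concentration predicts, with level `x`. -/
def Clean (M : MDP S A) (μ₀ : Measure S) (Φ : Set (Policy S A)) (c x : ℝ) (T : ℕ) (s : ℕ → S)
    (π : ℕ → Policy S A) : Prop :=
  ∀ t < T, ∀ φ ∈ Φ, 0 < playCount π t φ →
    |(∑ j ∈ Finset.range t, if π j = φ then M.r (s j, φ.1 (s j)) else 0) -
        playCount π t φ * avgReward M μ₀ φ| ≤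
      c * (√(x * playCount π t φ) + episodeCount π t φ)

end Path

section Event

variable {S A Ω : Type*} [MeasurableSpace S] [MeasurableSpace A] [mΩ : MeasurableSpace Ω]
  {P : Measure Ω} {M : MDP S A} {μ₀ : Measure S} {O : Finset (Policy S A × ℝ) → Option (Policy S A)}
  {C α LJ cd δ : ℝ} {T : ℕ} {ℱ : Filtration ℕ mΩ} {s : ℕ → Ω → S} {π : ℕ → Ω → Policy S A}
  {act : ℕ → Ω → Finset (Policy S A)} {Φ : Set (Policy S A)}
  {ρΦ : Policy S A → Policy S A → ℝ≥0∞}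

/-- A union bound over the time of the first play and the number of plays. -/
theorem IsProcess.ofReal_le_measure_clean [IsProbabilityMeasure P] [IsProbabilityMeasure μ₀]
    (h : IsProcess P M μ₀ O C α LJ cd δ T ℱ s π act) (hO : IsCoveringOracle Φ ρΦ O)
    (hE : UniformlyErgodic M C α Φ) (hC : 0 < C) (hα : 0 < α) (hα' : α < 1)
    {x : ℝ} (hx : 0 ≤ x) (hδ : 0 ≤ δ) (hxδ : T * T * (2 * Real.exp (-(2 * x))) ≤ δ) :
    ENNReal.ofReal (1 - δ) ≤
      P {ω | Clean M μ₀ Φ (C / (1 - α)) x T (fun t => s t ω) (fun t => π t ω)} := by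
  classical
  have : Nonempty (ProbabilityMeasure S) := ⟨⟨μ₀, inferInstance⟩⟩
  choose! μ hμ using fun φ hφ => (hE φ hφ).exists
  have h1α : 0 < 1 - α := by linarith
  set b := C / (2 * (1 - α)) with hb
  have hb0 : 0 < b := by positivity
  have h2b : 2 * b = C / (1 - α) := by
    rw [hb, ← div_div, mul_div_assoc', mul_div_cancel₀ _ two_ne_zero]
  set bad : ℕ → ℕ → Set Ω := fun k n => {ω | 2 * b * √(x * n) ≤
    |deviation M (π k ω) (bias M (π k ω) (μ (π k ω))) (fun t => s t ω) (fun t => π t ω)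
      n k (T - 1)|} with hbad
  have hbadle : ∀ k ∈ Finset.range T, ∀ n ∈ Finset.Icc 1 T,
      P (bad k n) ≤ ENNReal.ofReal (2 * Real.exp (-(2 * x))) := by
    intro k hk n hn
    have hk := Finset.mem_range.1 hk
    refine h.measure_abs_deviation_le (f := fun φ => bias M φ (μ φ)) (fun φ => measurable_bias)
      hb0 (by lia) (by lia) (fun ω y => ?_) (Finset.mem_Icc.1 hn).1 hx
    exact abs_bias_le (hμ _ ((h.run ω).act_subset hO hk ((h.run ω).mem_act hk))) hC.le hα.le hα' y
  have hsub : {ω | Clean M μ₀ Φ (C / (1 - α)) x T (fun t => s t ω) (fun t => π t ω)}ᶜ ⊆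
      ⋃ k ∈ Finset.range T, ⋃ n ∈ Finset.Icc 1 T, bad k n := by
    intro ω hω
    by_contra hnot
    refine hω fun t ht φ hφ hN => ?_
    obtain ⟨j₀, hj₀, hj₀φ⟩ := exists_lt_of_playCount_pos hN
    have hex : ∃ j, π j ω = φ := ⟨j₀, hj₀φ⟩
    have hkt : Nat.find hex < t := (Nat.find_min' hex hj₀φ).trans_lt hj₀
    set k := Nat.find hex with hk
    have hkφ : π k ω = φ := Nat.find_spec hex
    have hNt : playCount (fun t => π t ω) t φ ≤ t := playCount_le _ _ _
    have hdev : |deviation M φ (bias M φ (μ φ)) (fun t => s t ω) (fun t => π t ω)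
        (playCount (fun t => π t ω) t φ) k (T - 1)| <
        2 * b * √(x * playCount (fun t => π t ω) t φ) := by
      by_contra! hge
      refine hnot (Set.mem_biUnion (x := k) (Finset.mem_coe.2 (Finset.mem_range.2 (by lia)))
        (Set.mem_biUnion (x := playCount (fun t => π t ω) t φ)
          (Finset.mem_coe.2 (Finset.mem_Icc.2 ⟨hN, by lia⟩)) ?_))
      rw [hbad, Set.mem_ofPred_eq, hkφ]
      exact hge
    rw [avgReward_eq_statReward (hμ φ hφ) hC.le hα.le hα']
    refine (abs_rewards_sub_le (hμ φ hφ) hC.le hα.le hα' (h.run ω).keep ht.le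
      (fun j hj => Nat.find_min' hex hj) (by lia : t ≤ T - 1)).trans ?_
    rw [mul_add, ← h2b]
    exact add_le_add hdev.le le_rfl
  have hle : P {ω | Clean M μ₀ Φ (C / (1 - α)) x T (fun t => s t ω) (fun t => π t ω)}ᶜ ≤
      ENNReal.ofReal δ := by
    calc _ ≤ ∑ k ∈ Finset.range T, ∑ n ∈ Finset.Icc 1 T, P (bad k n) :=
          (measure_mono hsub).trans ((measure_biUnion_finset_le _ _).trans
            (Finset.sum_le_sum fun k _ => measure_biUnion_finset_le _ _))
      _ ≤ ∑ k ∈ Finset.range T, ∑ n ∈ Finset.Icc 1 T,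
            ENNReal.ofReal (2 * Real.exp (-(2 * x))) :=
          Finset.sum_le_sum fun k hk => Finset.sum_le_sum fun n hn => hbadle k hk n hn
      _ = ENNReal.ofReal (T * T * (2 * Real.exp (-(2 * x)))) := by
          rw [ENNReal.ofReal_mul (by positivity), ENNReal.ofReal_mul (by positivity)]
          simp [mul_assoc]
      _ ≤ ENNReal.ofReal δ := ENNReal.ofReal_le_ofReal hxδ
  rw [ENNReal.ofReal_sub _ hδ, ENNReal.ofReal_one, tsub_le_iff_right, ← measure_univ (μ := P)]
  refine le_trans ?_ (add_le_add le_rfl hle)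
  rw [← Set.union_compl_self
    {ω | Clean M μ₀ Φ (C / (1 - α)) x T (fun t => s t ω) (fun t => π t ω)}]
  exact measure_union_le _ _

end Event

/-! ### Covering numbers and the zooming dimension -/

section Covering

/-- A separated subset has at most as many elements as a cover, because each member of the cover
contains at most one of them. -/
theorem card_le_coveringNumber {P : Type*} {ρP : P → P → ℝ≥0∞} {ε : ℝ} {Y : Set P} {X : Finset P}
    (hX : (X : Set P) ⊆ Y) (hsep : (X : Set P).Pairwise fun a b =>
      ¬ (ρP a b ≤ ENNReal.ofReal ε ∧ ρP b a ≤ ENNReal.ofReal ε)) :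
    (X.card : ℕ∞) ≤ coveringNumber ρP ε Y := by
  refine le_iInf₂ fun 𝒞 h𝒞 => ?_
  choose! U hU hxU using fun x (hx : x ∈ (X : Set P)) => h𝒞.2 (hX hx)
  rw [← Set.encard_coe_eq_coe_finsetCard]
  refine Set.encard_le_encard_of_injOn (f := U) (fun x hx => hU x hx) fun x hx y hy hxy => ?_
  by_contra hne
  have hyU : y ∈ U x := hxy ▸ hxU y hy
  have := (h𝒞.1 (U x) (hU x hx)).2
  exact hsep hx hy hne ⟨this x (hxU x hx) y hyU, this y hyU x (hxU x hx)⟩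

variable {S A : Type*} [MeasurableSpace S] [MeasurableSpace A] {M : MDP S A} {μ₀ : Measure S}
  {Φ : Set (Policy S A)} {ρΦ : Policy S A → Policy S A → ℝ≥0∞} {cz cz₁ cz₂ : ℝ}

theorem zoomingDim_nonneg : 0 ≤ zoomingDim M μ₀ Φ ρΦ cz cz₁ cz₂ :=
  Real.sInf_nonneg fun _ h => h.1.le

/-- The covering bounds persist at the infimum of the exponents, by continuity. -/
theorem coveringNumber_le_zoomingDim (hne : (zoomingSet M μ₀ Φ ρΦ cz cz₁ cz₂).Nonempty)
    (h₁ : 0 ≤ cz₁) (h₂ : 0 ≤ cz₂) {γ : ℝ} (hγ : 0 < γ) (hγ1 : γ ≤ 1) :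
    (coveringNumber ρΦ (γ / cz) (layer M μ₀ Φ γ) : ℝ≥0∞) ≤
      ENNReal.ofReal (cz₁ * γ ^ (-zoomingDim M μ₀ Φ ρΦ cz cz₁ cz₂)) ∧
    (coveringNumber ρΦ (γ / cz) (nearOpt M μ₀ Φ γ) : ℝ≥0∞) ≤
      ENNReal.ofReal (cz₂ * γ ^ (-zoomingDim M μ₀ Φ ρΦ cz cz₁ cz₂)) := by
  set d := zoomingDim M μ₀ Φ ρΦ cz cz₁ cz₂ with hd
  have htends : ∀ a : ℝ, Tendsto (fun ε : ℝ => ENNReal.ofReal (a * γ ^ (-(d + ε))))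
      (nhdsWithin 0 (Set.Ioi 0)) (nhds (ENNReal.ofReal (a * γ ^ (-d)))) := by
    intro a
    have hc : Continuous fun ε : ℝ => ENNReal.ofReal (a * γ ^ (-(d + ε))) :=
      ENNReal.continuous_ofReal.comp (continuous_const.mul
        (continuous_const.rpow (by fun_prop) fun _ => Or.inl hγ.ne'))
    have := hc.tendsto 0
    rw [add_zero] at this
    exact this.mono_left nhdsWithin_le_nhds
  have hpow : ∀ ε : ℝ, 0 < ε → ∃ d' ∈ zoomingSet M μ₀ Φ ρΦ cz cz₁ cz₂,
      γ ^ (-d') ≤ γ ^ (-(d + ε)) := by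
    intro ε hε
    obtain ⟨d', hd', hlt⟩ := exists_lt_of_csInf_lt hne (show sInf _ < d + ε by
      rw [hd, zoomingDim]; linarith)
    exact ⟨d', hd', Real.rpow_le_rpow_of_exponent_ge hγ hγ1 (by linarith)⟩
  constructor
  · refine ge_of_tendsto (htends cz₁) (eventually_nhdsWithin_of_forall fun ε hε => ?_)
    obtain ⟨d', hd', hle⟩ := hpow ε hε
    exact (hd'.2 γ hγ hγ1).1.trans
      (ENNReal.ofReal_le_ofReal (mul_le_mul_of_nonneg_left hle h₁))
  · refine ge_of_tendsto (htends cz₂) (eventually_nhdsWithin_of_forall fun ε hε => ?_)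
    obtain ⟨d', hd', hle⟩ := hpow ε hε
    exact (hd'.2 γ hγ hγ1).2.trans
      (ENNReal.ofReal_le_ofReal (mul_le_mul_of_nonneg_left hle h₂))

theorem card_le_of_coveringNumber_le {P : Type*} {ρP : P → P → ℝ≥0∞} {ε a : ℝ} {Y : Set P}
    {X : Finset P} (hX : (X : Set P) ⊆ Y) (hsep : (X : Set P).Pairwise fun a b =>
      ¬ (ρP a b ≤ ENNReal.ofReal ε ∧ ρP b a ≤ ENNReal.ofReal ε)) (ha : 0 ≤ a)
    (hcov : (coveringNumber ρP ε Y : ℝ≥0∞) ≤ ENNReal.ofReal a) : (X.card : ℝ) ≤ a := by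
  have h1 : ((X.card : ℕ∞) : ℝ≥0∞) ≤ ENNReal.ofReal a :=
    (ENat.toENNReal_le.2 (card_le_coveringNumber hX hsep)).trans hcov
  rw [ENat.toENNReal_coe, ← ENNReal.ofReal_natCast] at h1
  exact (ENNReal.ofReal_le_ofReal_iff ha).1 h1

/-! ### Optimality gaps -/

variable {C α : ℝ} [IsProbabilityMeasure μ₀]

theorem avgReward_mem_Icc (hE : UniformlyErgodic M C α Φ) (hC : 0 ≤ C) (hα : 0 ≤ α)
    (hα' : α < 1) {φ : Policy S A} (hφ : φ ∈ Φ) : avgReward M μ₀ φ ∈ Set.Icc (0 : ℝ) 1 := by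
  obtain ⟨μ, h, -⟩ := hE φ hφ
  rw [avgReward_eq_statReward h hC hα hα']
  exact integral_mem_Icc _ (measurable_expReward M φ 0) (expReward_mem_Icc M φ 0)

theorem optReward_le_one (hE : UniformlyErgodic M C α Φ) (hC : 0 ≤ C) (hα : 0 ≤ α)
    (hα' : α < 1) (hΦ : Φ.Nonempty) : optReward M μ₀ Φ ≤ 1 := by
  refine csSup_le (hΦ.image _) ?_
  rintro _ ⟨φ, hφ, rfl⟩
  exact (avgReward_mem_Icc hE hC hα hα' hφ).2

end Covering

/-! ### Consequences of a clean trajectory -/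

section CleanRun

variable {S A : Type*} [MeasurableSpace S] [MeasurableSpace A] {M : MDP S A} {μ₀ : Measure S}
  {O : Finset (Policy S A × ℝ) → Option (Policy S A)} {C α LJ cd δ : ℝ} {T : ℕ} {s : ℕ → S}
  {π : ℕ → Policy S A} {act : ℕ → Finset (Policy S A)} {Φ : Set (Policy S A)}
  {ρΦ : Policy S A → Policy S A → ℝ≥0∞} {t : ℕ} {φ : Policy S A}

theorem policyDiam_nonneg (hc : 0 ≤ C / (1 - α)) (π : ℕ → Policy S A) (t : ℕ) (φ : Policy S A) :
    0 ≤ policyDiam C α cd δ T π t φ := by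
  unfold policyDiam
  positivity

open Classical in
/-- On a clean trajectory the empirical mean of each policy of the class is within its diameter of
the average reward. For unplayed policies this holds because the initial diameter is at least `1`,
the range of the rewards. -/
theorem Clean.abs_mean_sub_le (h : Clean M μ₀ Φ (C / (1 - α)) (cd * Real.log (T / δ)) T s π)
    (hc : 0 < C / (1 - α)) (hx : 0 ≤ cd * Real.log (T / δ))
    (hbig : 1 ≤ C / (1 - α) * (√(cd * Real.log (T / δ)) + 1))
    (hJ : ∀ φ ∈ Φ, avgReward M μ₀ φ ∈ Set.Icc (0 : ℝ) 1) (ht : t < T) (hφ : φ ∈ Φ) :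
    |(∑ i ∈ Finset.range t, if π i = φ then M.r (s i, φ.1 (s i)) else 0) /
      (max 1 (playCount π t φ) : ℕ) - avgReward M μ₀ φ| ≤ policyDiam C α cd δ T π t φ := by
  set x := cd * Real.log (T / δ) with hxdef
  have hd : policyDiam C α cd δ T π t φ = C / (1 - α) * (√(x / (max 1 (playCount π t φ) : ℕ)) +
    (1 + episodeCount π t φ) / (max 1 (playCount π t φ) : ℕ)) := rfl
  rw [hd]
  rcases Nat.eq_zero_or_pos (playCount π t φ) with h0 | hpos
  · have hsum : (∑ i ∈ Finset.range t, if π i = φ then M.r (s i, φ.1 (s i)) else 0) = 0 := by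
      refine Finset.sum_eq_zero fun i hi => if_neg fun hπ => ?_
      have h1 : playCount π (i + 1) φ ≤ playCount π t φ :=
        playCount_mono π φ (Finset.mem_range.1 hi)
      rw [playCount_succ, if_pos hπ] at h1
      lia
    have hJφ := hJ φ hφ
    rw [hsum, h0, zero_div, zero_sub, abs_neg, abs_of_nonneg hJφ.1]
    simp only [zero_le, sup_of_le_left, Nat.cast_one, div_one]
    refine hJφ.2.trans (hbig.trans (mul_le_mul_of_nonneg_left ?_ hc.le))
    linarith [(Nat.cast_nonneg (episodeCount π t φ) : (0 : ℝ) ≤ _)]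
  · have hcl := h t ht φ hφ hpos
    rw [max_eq_right (Nat.one_le_iff_ne_zero.2 hpos.ne')]
    set N : ℝ := (playCount π t φ : ℝ) with hN
    have hNpos : 0 < N := Nat.cast_pos.2 hpos
    have e1 : ∀ a : ℝ, a / N - avgReward M μ₀ φ = (a - N * avgReward M μ₀ φ) / N := fun a => by
      field_simp
    have e2 : √(x / N) = √(x * N) / N := by
      rw [show x / N = x * N / N ^ 2 by field_simp, Real.sqrt_div (by positivity),
        Real.sqrt_sq hNpos.le]
    rw [e1, abs_div, abs_of_pos hNpos, div_le_iff₀ hNpos, e2]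
    refine hcl.trans ?_
    rw [mul_assoc (C / (1 - α)), add_mul, div_mul_cancel₀ _ hNpos.ne', div_mul_cancel₀ _ hNpos.ne']
    refine mul_le_mul_of_nonneg_left ?_ hc.le
    linarith

/-- The optimistic choice: when an episode starts, the gap of the chosen policy is at most a
multiple of its diameter. -/
theorem IsRun.gap_le_of_newEpisode (h : IsRun M O C α LJ cd δ T s π act)
    (hO : IsCoveringOracle Φ ρΦ O)
    (hcl : Clean M μ₀ Φ (C / (1 - α)) (cd * Real.log (T / δ)) T s π)
    (hc : 0 < C / (1 - α)) (hx : 0 ≤ cd * Real.log (T / δ))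
    (hbig : 1 ≤ C / (1 - α) * (√(cd * Real.log (T / δ)) + 1))
    (hJ : ∀ φ ∈ Φ, avgReward M μ₀ φ ∈ Set.Icc (0 : ℝ) 1) (hLJ : 0 ≤ LJ)
    (hlip : ∀ φ ∈ Φ, ∀ ψ ∈ Φ,
      ENNReal.ofReal |avgReward M μ₀ φ - avgReward M μ₀ ψ| ≤ ENNReal.ofReal LJ * ρΦ φ ψ)
    (hΦ : Φ.Nonempty) (ht : t < T) (hnew : NewEpisode π t) :
    gap M μ₀ Φ (π t) ≤ (2 + LJ) * policyDiam C α cd δ T π t (π t) := by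
  classical
  have hmean := fun {φ} => hcl.abs_mean_sub_le hc hx hbig hJ ht (φ := φ)
  have hactΦ := h.act_subset hO ht
  rw [gap, sub_le_iff_le_add]
  refine csSup_le (hΦ.image _) ?_
  rintro _ ⟨ψ, hψ, rfl⟩
  obtain ⟨φ, hφ, hle⟩ := (h.activate t ht).exists_le hO hψ
  have hdφ := policyDiam_nonneg (cd := cd) (δ := δ) (T := T) hc.le π t φ
  have h1 : |avgReward M μ₀ ψ - avgReward M μ₀ φ| ≤ LJ * policyDiam C α cd δ T π t φ := by
    rw [← ENNReal.ofReal_le_ofReal_iff (mul_nonneg hLJ hdφ), ENNReal.ofReal_mul hLJ]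
    exact (hlip ψ hψ φ (hactΦ hφ)).trans (mul_le_mul_right hle _)
  have h2 := (h.choose t ht hnew).2 φ hφ
  have h3 := abs_le.1 (hmean (hactΦ hφ))
  have h4 := abs_le.1 (hmean (hactΦ (h.mem_act ht)))
  have h1 := (abs_le.1 h1).2
  unfold ucbIndex at h2
  linarith [h3.1, h4.2]

/-- The diameter of a policy at the start of an episode, after `k` episodes. -/
def startDiam (c x : ℝ) (k : ℕ) : ℝ :=
  c * (√(x / 2 ^ (k - 1)) + (1 + k) / 2 ^ (k - 1))

theorem IsRun.gap_le_startDiam (h : IsRun M O C α LJ cd δ T s π act)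
    (hnew : ∀ t < T, NewEpisode π t →
      gap M μ₀ Φ (π t) ≤ (2 + LJ) * policyDiam C α cd δ T π t (π t)) (ht : t ≤ T) {k : ℕ}
    (hk : episodeCount π t φ = k + 1) :
    gap M μ₀ Φ φ ≤ (2 + LJ) * startDiam (C / (1 - α)) (cd * Real.log (T / δ)) k := by
  classical
  induction t with
  | zero => simp [episodeCount] at hk
  | succ t ih =>
    rw [episodeCount_succ] at hk
    split_ifs at hk with hs
    · obtain ⟨hs, rfl⟩ := hs
      have hN := playCount_eq_of_newEpisode h.keep (by lia : t ≤ T) hs (π t)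
      have hk : episodeCount π t (π t) = k := by lia
      have := hnew t ht hs
      rw [policyDiam, hN, hk, max_one_doublingCount] at this
      rw [startDiam]
      exact_mod_cast this
    · exact ih (by lia) hk

theorem IsRun.max_one_playCount_le (h : IsRun M O C α LJ cd δ T s π act) (ht : t ≤ T) {k : ℕ}
    (hk : episodeCount π t φ = k + 1) :
    ((max 1 (playCount π t φ) : ℕ) : ℝ) ≤ 2 * 2 ^ (k - 1) := by
  have h1 := (playCount_mem_Ioc h.keep ht hk).2
  have h2 : max 1 (playCount π t φ) ≤ 2 * 2 ^ (k - 1) := by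
    rw [doublingCount_succ, max_one_doublingCount] at h1
    have h3 : doublingCount k ≤ 2 ^ (k - 1) := by
      rw [← max_one_doublingCount]; exact le_max_right _ _
    have : 1 ≤ 2 ^ (k - 1) := Nat.one_le_two_pow
    exact max_le (by lia) (by lia)
  exact_mod_cast h2

/-- Within an episode the number of plays at most doubles, so that at all times, and not just at the
starts of episodes, gaps are controlled by diameters. -/
theorem IsRun.gap_le_policyDiam (h : IsRun M O C α LJ cd δ T s π act)
    (hnew : ∀ t < T, NewEpisode π t →
      gap M μ₀ Φ (π t) ≤ (2 + LJ) * policyDiam C α cd δ T π t (π t))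
    (hc : 0 < C / (1 - α)) (hx : 0 ≤ cd * Real.log (T / δ))
    (hbig : 1 ≤ C / (1 - α) * (√(cd * Real.log (T / δ)) + 1)) (hLJ : 0 ≤ LJ)
    (hgap : gap M μ₀ Φ φ ≤ 1) (ht : t ≤ T) :
    gap M μ₀ Φ φ ≤ 2 * (2 + LJ) * policyDiam C α cd δ T π t φ := by
  set x := cd * Real.log (T / δ) with hxdef
  have hd : policyDiam C α cd δ T π t φ = C / (1 - α) * (√(x / (max 1 (playCount π t φ) : ℕ)) +
    (1 + episodeCount π t φ) / (max 1 (playCount π t φ) : ℕ)) := rfl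
  rcases hK : episodeCount π t φ with _ | k
  · have hN := playCount_eq_zero h.keep ht hK
    have h1 : 1 ≤ policyDiam C α cd δ T π t φ := by
      rw [hd, hN, hK]
      simpa using hbig
    nlinarith
  · have h1 := h.gap_le_startDiam hnew ht hK
    have h2 := h.max_one_playCount_le ht hK
    have h3 : (1 : ℝ) ≤ (max 1 (playCount π t φ) : ℕ) := by exact_mod_cast le_max_left _ _
    have h4 : startDiam (C / (1 - α)) x k ≤ 2 * policyDiam C α cd δ T π t φ := by
      rw [hd, startDiam, hK, mul_left_comm]
      refine mul_le_mul_of_nonneg_left ?_ hc.le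
      set m : ℝ := 2 ^ (k - 1) with hm
      have hm0 : 0 < m := by positivity
      set N : ℝ := ((max 1 (playCount π t φ) : ℕ) : ℝ)
      rw [mul_add]
      refine add_le_add ?_ ?_
      · rw [show (2 : ℝ) * √(x / N) = √(4 * (x / N)) by
          rw [Real.sqrt_mul (by norm_num), show (4 : ℝ) = 2 ^ 2 by norm_num,
            Real.sqrt_sq (by norm_num)]]
        refine Real.sqrt_le_sqrt ?_
        rw [mul_div_assoc', div_le_div_iff₀ hm0 (by linarith)]
        nlinarith
      · rw [mul_div_assoc', div_le_div_iff₀ hm0 (by linarith)]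
        push_cast
        have : (0 : ℝ) ≤ k := Nat.cast_nonneg k
        nlinarith
    calc _ ≤ (2 + LJ) * startDiam (C / (1 - α)) x k := h1
      _ ≤ (2 + LJ) * (2 * policyDiam C α cd δ T π t φ) :=
          mul_le_mul_of_nonneg_left h4 (by linarith)
      _ = _ := by ring

theorem one_add_le_three_mul_sqrt_two_pow (k : ℕ) :
    ((1 + k : ℕ) : ℝ) ≤ 3 * √((2 : ℝ) ^ (k - 1)) := by
  have h : (1 + k) ^ 2 ≤ 9 * 2 ^ (k - 1) := by
    cases k with
    | zero => norm_num
    | succ k =>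
      rw [Nat.add_sub_cancel]
      induction k with
      | zero => norm_num
      | succ k ih =>
        rcases Nat.lt_or_ge k 1 with hk | hk
        · obtain rfl : k = 0 := by lia
          norm_num
        · rw [pow_succ 2 k]
          nlinarith
  have h' : ((1 + k : ℕ) : ℝ) ^ 2 ≤ 9 * 2 ^ (k - 1) := by exact_mod_cast h
  have e : (3 * √((2 : ℝ) ^ (k - 1))) = √(9 * 2 ^ (k - 1)) := by
    rw [Real.sqrt_mul (by norm_num), show (9 : ℝ) = 3 ^ 2 by norm_num, Real.sqrt_sq (by norm_num)]
  rw [e]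
  exact Real.le_sqrt_of_sq_le h'

/-- The total gap and the boundary terms of a policy are of the order of the square root of its
number of plays. -/
theorem IsRun.playCount_mul_gap_le (h : IsRun M O C α LJ cd δ T s π act)
    (hnew : ∀ t < T, NewEpisode π t →
      gap M μ₀ Φ (π t) ≤ (2 + LJ) * policyDiam C α cd δ T π t (π t))
    (hc : 0 < C / (1 - α)) (hx : 1 ≤ cd * Real.log (T / δ)) (hLJ : 0 ≤ LJ)
    (ht : t ≤ T) (hN : 0 < playCount π t φ) :
    playCount π t φ * gap M μ₀ Φ φ ≤ 8 * (2 + LJ) *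
      (C / (1 - α) * √(cd * Real.log (T / δ))) * √(playCount π t φ) ∧
    C / (1 - α) * (√(cd * Real.log (T / δ) * playCount π t φ) + episodeCount π t φ) ≤
      4 * (C / (1 - α) * √(cd * Real.log (T / δ))) * √(playCount π t φ) := by
  set x := cd * Real.log (T / δ) with hxdef
  rcases hK : episodeCount π t φ with _ | k
  · rw [playCount_eq_zero h.keep ht hK] at hN
    exact absurd hN (lt_irrefl 0)
  have h1 := h.gap_le_startDiam hnew ht hK
  have h2 := h.max_one_playCount_le ht hK
  have h3 : (2 : ℝ) ^ (k - 1) ≤ playCount π t φ := by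
    have := (playCount_mem_Ioc h.keep ht hK).1
    have h4 : max 1 (doublingCount k) ≤ playCount π t φ := max_le hN this.le
    rw [max_one_doublingCount] at h4
    exact_mod_cast h4
  rw [max_eq_right (Nat.one_le_iff_ne_zero.2 hN.ne')] at h2
  set N : ℝ := (playCount π t φ : ℝ) with hNdef
  have hNpos : 0 < N := Nat.cast_pos.2 hN
  set m : ℝ := 2 ^ (k - 1) with hm
  have hm0 : 0 < m := by positivity
  have hk := one_add_le_three_mul_sqrt_two_pow k
  rw [← hm] at hk
  have hmN : √m ≤ √N := Real.sqrt_le_sqrt h3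
  have hx1 : 1 ≤ √x := Real.one_le_sqrt.2 hx
  have hsN : 0 ≤ √N := Real.sqrt_nonneg N
  have hxN : √(x * N) = √x * √N := Real.sqrt_mul (by linarith) N
  have hk' : (1 + k : ℝ) ≤ 3 * √N := by push_cast at hk; linarith
  have hNx : √N ≤ √x * √N := le_mul_of_one_le_left hsN hx1
  constructor
  · have e1 : N * √(x / m) ≤ 2 * (√x * √N) := by
      have : N * √(x / m) = √(x * N) * √(N / m) := by
        rw [← Real.sqrt_mul (by positivity), show x * N * (N / m) = N ^ 2 * (x / m) by ring,
          Real.sqrt_mul (by positivity), Real.sqrt_sq hNpos.le]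
      rw [this, hxN, mul_comm (2 : ℝ)]
      refine mul_le_mul_of_nonneg_left ?_ (by positivity)
      rw [show (2 : ℝ) = √(2 ^ 2) from (Real.sqrt_sq (by norm_num)).symm]
      refine Real.sqrt_le_sqrt ?_
      rw [div_le_iff₀ hm0]; linarith
    have e2 : N * ((1 + k) / m) ≤ 2 * (1 + k) := by
      rw [mul_div_assoc', div_le_iff₀ hm0]
      nlinarith [(Nat.cast_nonneg k : (0 : ℝ) ≤ k)]
    have e3 : N * startDiam (C / (1 - α)) x k ≤ C / (1 - α) * (8 * (√x * √N)) := by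
      rw [startDiam, mul_left_comm]
      refine mul_le_mul_of_nonneg_left ?_ hc.le
      rw [mul_add]
      linarith
    calc N * gap M μ₀ Φ φ ≤ N * ((2 + LJ) * startDiam (C / (1 - α)) x k) :=
          mul_le_mul_of_nonneg_left h1 hNpos.le
      _ = (2 + LJ) * (N * startDiam (C / (1 - α)) x k) := by ring
      _ ≤ (2 + LJ) * (C / (1 - α) * (8 * (√x * √N))) :=
          mul_le_mul_of_nonneg_left e3 (by linarith)
      _ = _ := by ring
  · have : C / (1 - α) * (√(x * N) + ((k + 1 : ℕ) : ℝ)) ≤ C / (1 - α) * (4 * (√x * √N)) := by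
      refine mul_le_mul_of_nonneg_left ?_ hc.le
      rw [hxN]; push_cast; linarith
    exact this.trans (le_of_eq (by ring))

end CleanRun

/-! ### Summation over the layers of the policy class -/

section Layers

variable {P : Type*} {X : Finset P} {g q : P → ℝ} {B a d γ : ℝ}

open Classical in
/-- Contribution of the policies with gap `g` above `γ`: dyadic layers contribute a geometric
series. -/
theorem sum_far_le (hg1 : ∀ φ ∈ X, g φ ≤ 1) (hB : 0 ≤ B) (hqg : ∀ φ ∈ X, q φ * g φ ≤ B)
    (hq : ∀ φ ∈ X, 0 ≤ q φ) (ha : 0 ≤ a) (hd : 0 ≤ d)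
    (hfar : ∀ γ : ℝ, 0 < γ → γ ≤ 1 →
      (({φ ∈ X | γ < g φ ∧ g φ ≤ 2 * γ}.card : ℕ) : ℝ) ≤ a * γ ^ (-d)) (hγ : 0 < γ) :
    ∑ φ ∈ X with γ < g φ, q φ ≤ 2 * (a * B * (γ ^ (-d) / γ)) := by
  have hj : ∀ φ ∈ X, γ < g φ → ∃ j : ℕ, 2 ^ j * γ < g φ ∧ g φ ≤ 2 * (2 ^ j * γ) := by
    intro φ _ hφ
    have hex : ∃ n : ℕ, g φ ≤ 2 * (2 ^ n * γ) := by
      obtain ⟨n, hn⟩ := pow_unbounded_of_one_lt (g φ / γ) (one_lt_two (α := ℝ))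
      rw [div_lt_iff₀ hγ] at hn
      exact ⟨n, by nlinarith [show 0 < (2 : ℝ) ^ n * γ by positivity]⟩
    refine ⟨Nat.find hex, ?_, Nat.find_spec hex⟩
    rcases h : Nat.find hex with _ | n
    · simpa using hφ
    · have := Nat.find_min hex (m := n) (by lia)
      rw [not_le] at this
      calc (2 : ℝ) ^ (n + 1) * γ = 2 * (2 ^ n * γ) := by ring
        _ < g φ := this
  choose! j hj1 hj2 using hj
  set Y := {φ ∈ X | γ < g φ} with hY
  have hYX : ∀ {φ}, φ ∈ Y → φ ∈ X ∧ γ < g φ := fun h => Finset.mem_filter.1 h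
  have hfiber : ∀ i ∈ Y.image j, ∑ φ ∈ Y with j φ = i, q φ ≤
      (a * B * (γ ^ (-d) / γ)) * (1 / 2) ^ i := by
    intro i hi
    obtain ⟨φ₀, hφ₀, rfl⟩ := Finset.mem_image.1 hi
    set i := j φ₀
    have hβ : 0 < (2 : ℝ) ^ i * γ := by positivity
    have hβ1 : (2 : ℝ) ^ i * γ ≤ 1 :=
      (hj1 φ₀ (hYX hφ₀).1 (hYX hφ₀).2).le.trans (hg1 φ₀ (hYX hφ₀).1)
    have hcard : (({φ ∈ Y | j φ = i}.card : ℕ) : ℝ) ≤ a * γ ^ (-d) := by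
      refine le_trans (Nat.cast_le.2 (Finset.card_le_card ?_)) ((hfar _ hβ hβ1).trans ?_)
      · intro φ hφ
        obtain ⟨hφY, hφi⟩ := Finset.mem_filter.1 hφ
        have h1 := hj1 φ (hYX hφY).1 (hYX hφY).2
        have h2 := hj2 φ (hYX hφY).1 (hYX hφY).2
        rw [hφi] at h1 h2
        exact Finset.mem_filter.2 ⟨(hYX hφY).1, h1, h2⟩
      · refine mul_le_mul_of_nonneg_left ?_ ha
        refine Real.rpow_le_rpow_of_nonpos hγ ?_ (by linarith)
        exact le_mul_of_one_le_left hγ.le (one_le_pow₀ one_le_two)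
    have hterm : ∀ φ ∈ {φ ∈ Y | j φ = i}, q φ ≤ B / (2 ^ i * γ) := by
      intro φ hφ
      obtain ⟨hφY, hφi⟩ := Finset.mem_filter.1 hφ
      have h1 := hj1 φ (hYX hφY).1 (hYX hφY).2
      rw [hφi] at h1
      rw [le_div_iff₀ hβ]
      exact (mul_le_mul_of_nonneg_left h1.le (hq φ (hYX hφY).1)).trans (hqg φ (hYX hφY).1)
    refine (Finset.sum_le_card_nsmul _ _ _ hterm).trans ?_
    rw [nsmul_eq_mul]
    refine (mul_le_mul_of_nonneg_right hcard (by positivity)).trans (le_of_eq ?_)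
    rw [one_div, inv_pow]
    field_simp
  have hK : 0 ≤ a * B * (γ ^ (-d) / γ) := by positivity
  rw [← Finset.sum_fiberwise_of_maps_to (t := Y.image j) (g := j)
    fun φ hφ => Finset.mem_image_of_mem j hφ]
  refine (Finset.sum_le_sum hfiber).trans ?_
  rw [← Finset.mul_sum, mul_comm (2 : ℝ)]
  refine mul_le_mul_of_nonneg_left ?_ hK
  exact (summable_geometric_two.sum_le_tsum _ fun i _ => by positivity).trans
    tsum_geometric_two.le

/-- Here `q φ` stands for the square root of the number of plays of `φ`. Policies with gap at most
`γ` are split further: those with many plays are few, because all plays sum up to at most `τ`, and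
those with few plays are counted by a covering number. -/
theorem sum_le_of_layers {a₁ a₂ H τ : ℝ} (hg1 : ∀ φ ∈ X, g φ ≤ 1) (hB : 0 ≤ B)
    (hqg : ∀ φ ∈ X, q φ * g φ ≤ B) (hq : ∀ φ ∈ X, 0 ≤ q φ) (ha₁ : 0 ≤ a₁)
    (hd : 0 ≤ d) (hH : 1 ≤ H) (hτ : ∑ φ ∈ X, q φ ^ 2 ≤ τ)
    (hfar : ∀ γ : ℝ, 0 < γ → γ ≤ 1 → ∀ Y ⊆ X, (∀ φ ∈ Y, γ < g φ ∧ g φ ≤ 2 * γ) →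
      (Y.card : ℝ) ≤ a₁ * γ ^ (-d))
    (hγ : 0 < γ)
    (hnear : ∀ Y ⊆ X, (∀ φ ∈ Y, g φ ≤ γ ∧ q φ ≤ H / γ) → (Y.card : ℝ) ≤ a₂ * γ ^ (-d)) :
    ∑ φ ∈ X, q φ ≤ γ * τ + (a₂ * H + 2 * (a₁ * B)) * (γ ^ (-d) / γ) := by
  classical
  have h1 := sum_far_le hg1 hB hqg hq ha₁ hd (fun β hβ hβ1 => hfar β hβ hβ1 _
    (Finset.filter_subset _ _) fun φ hφ => (Finset.mem_filter.1 hφ).2) hγ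
  have h2 : ∑ φ ∈ X with ¬ γ < g φ ∧ q φ ≤ H / γ, q φ ≤ a₂ * H * (γ ^ (-d) / γ) := by
    refine (Finset.sum_le_card_nsmul _ _ (H / γ) fun φ hφ =>
      (Finset.mem_filter.1 hφ).2.2).trans ?_
    rw [nsmul_eq_mul]
    refine (mul_le_mul_of_nonneg_right (hnear _ (Finset.filter_subset _ _) fun φ hφ => ?_)
      (by positivity)).trans (le_of_eq (by ring))
    have := (Finset.mem_filter.1 hφ).2
    exact ⟨not_lt.1 this.1, this.2⟩
  have h3 : ∑ φ ∈ X with ¬ γ < g φ ∧ ¬ q φ ≤ H / γ, q φ ≤ γ * τ := by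
    calc _ ≤ ∑ φ ∈ X with ¬ γ < g φ ∧ ¬ q φ ≤ H / γ, γ * q φ ^ 2 := by
          refine Finset.sum_le_sum fun φ hφ => ?_
          obtain ⟨hφX, -, hφq⟩ := Finset.mem_filter.1 hφ
          have h4 : 1 / γ < q φ := (div_le_div_of_nonneg_right hH hγ.le).trans_lt (not_le.1 hφq)
          rw [div_lt_iff₀ hγ] at h4
          nlinarith [hq φ hφX]
      _ ≤ ∑ φ ∈ X, γ * q φ ^ 2 :=
          Finset.sum_le_sum_of_subset_of_nonneg (Finset.filter_subset _ _)
            fun φ _ _ => by positivity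
      _ = γ * ∑ φ ∈ X, q φ ^ 2 := (Finset.mul_sum _ _ _).symm
      _ ≤ γ * τ := mul_le_mul_of_nonneg_left hτ hγ.le
  rw [← Finset.sum_filter_add_sum_filter_not X (fun φ => γ < g φ) q,
    ← Finset.sum_filter_add_sum_filter_not ({φ ∈ X | ¬ γ < g φ}) (fun φ => q φ ≤ H / γ) q,
    Finset.filter_filter, Finset.filter_filter]
  linarith

end Layers

/-! ### The regret of a clean trajectory -/

section Regret

variable {S A : Type*} [MeasurableSpace S] [MeasurableSpace A] {M : MDP S A} {μ₀ : Measure S}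
  {O : Finset (Policy S A × ℝ) → Option (Policy S A)} {C α LJ cd δ : ℝ} {T n : ℕ} {s : ℕ → S}
  {π : ℕ → Policy S A} {act : ℕ → Finset (Policy S A)} {Φ : Set (Policy S A)}
  {ρΦ : Policy S A → Policy S A → ℝ≥0∞} {t : ℕ} {φ : Policy S A}

theorem sum_playCount_le {P : Type*} (π : ℕ → P) (n : ℕ) (X : Finset P) :
    ∑ φ ∈ X, playCount π n φ ≤ n := by
  classical
  simp only [playCount_eq_sum]
  rw [Finset.sum_comm]
  refine (Finset.sum_le_card_nsmul _ _ 1 fun j _ => ?_).trans (by simp)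
  rw [Finset.sum_ite_eq]
  split_ifs <;> simp

/-- Decomposition of the regret over policies. The last reward is split off, as the deviations are
only controlled before the last transition. -/
theorem IsRun.regret_le_sum_sqrt (h : IsRun M O C α LJ cd δ (n + 1) s π act)
    (hO : IsCoveringOracle Φ ρΦ O)
    (hcl : Clean M μ₀ Φ (C / (1 - α)) (cd * Real.log ((n + 1 : ℕ) / δ)) (n + 1) s π)
    (hnew : ∀ t < n + 1, NewEpisode π t →
      gap M μ₀ Φ (π t) ≤ (2 + LJ) * policyDiam C α cd δ (n + 1) π t (π t))
    (hc : 0 < C / (1 - α)) (hx : 1 ≤ cd * Real.log ((n + 1 : ℕ) / δ)) (hLJ : 0 ≤ LJ)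
    (hopt : optReward M μ₀ Φ ≤ 1) :
    regret M μ₀ Φ (n + 1) s π ≤ 1 + (8 * (2 + LJ) + 4) *
      (C / (1 - α) * √(cd * Real.log ((n + 1 : ℕ) / δ))) *
        ∑ φ ∈ act n, √(playCount π n φ) := by
  classical
  set G := C / (1 - α) * √(cd * Real.log ((n + 1 : ℕ) / δ)) with hG
  set J := optReward M μ₀ Φ with hJdef
  have hmem : ∀ t ∈ Finset.range n, π t ∈ act n := fun t ht =>
    h.act_mono (Finset.mem_range.1 ht).le n.lt_succ_self
      (h.mem_act ((Finset.mem_range.1 ht).trans n.lt_succ_self))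
  have hsplit : ∑ t ∈ Finset.range n, (J - M.r (s t, (π t).1 (s t))) =
      ∑ φ ∈ act n, ∑ t ∈ Finset.range n, if π t = φ then J - M.r (s t, φ.1 (s t)) else 0 := by
    rw [Finset.sum_comm]
    refine Finset.sum_congr rfl fun t ht => ?_
    rw [Finset.sum_ite_eq, if_pos (hmem t ht)]
  have hone : ∀ φ ∈ act n,
      (∑ t ∈ Finset.range n, if π t = φ then J - M.r (s t, φ.1 (s t)) else 0) ≤
        (8 * (2 + LJ) + 4) * G * √(playCount π n φ) := by
    intro φ hφ
    have e : (∑ t ∈ Finset.range n, if π t = φ then J - M.r (s t, φ.1 (s t)) else 0) =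
        playCount π n φ * gap M μ₀ Φ φ -
          ((∑ j ∈ Finset.range n, if π j = φ then M.r (s j, φ.1 (s j)) else 0) -
            playCount π n φ * avgReward M μ₀ φ) := by
      have hN : (playCount π n φ : ℝ) * J = ∑ j ∈ Finset.range n, if π j = φ then J else 0 := by
        rw [playCount_eq_sum, Nat.cast_sum, Finset.sum_mul]
        exact Finset.sum_congr rfl fun j _ => by split_ifs <;> simp
      rw [gap, mul_sub, hN, sub_sub_sub_cancel_right, ← Finset.sum_sub_distrib]
      exact Finset.sum_congr rfl fun j _ => by split_ifs <;> simp
    rw [e]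
    rcases Nat.eq_zero_or_pos (playCount π n φ) with h0 | hpos
    · have hne : ∀ j ∈ Finset.range n, π j ≠ φ := by
        intro j hj hπ
        have h1 : playCount π (j + 1) φ ≤ playCount π n φ :=
          playCount_mono π φ (Finset.mem_range.1 hj)
        rw [playCount_succ, if_pos hπ] at h1
        lia
      rw [h0, Finset.sum_eq_zero fun j hj => if_neg (hne j hj)]
      simp
    · have h1 := h.playCount_mul_gap_le hnew hc hx hLJ n.le_succ hpos
      have h2 := hcl n n.lt_succ_self φ (h.act_subset hO n.lt_succ_self hφ) hpos
      have h3 := (abs_le.1 (h2.trans h1.2)).1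
      have h4 := h1.1
      linarith
  have hlast := (M.r_mem (s n, (π n).1 (s n))).1
  have e : regret M μ₀ Φ (n + 1) s π = (J - M.r (s n, (π n).1 (s n))) +
      ∑ t ∈ Finset.range n, (J - M.r (s t, (π t).1 (s t))) := by
    rw [regret, Finset.sum_range_succ, Finset.sum_sub_distrib]
    simp
    ring
  rw [e, hsplit, Finset.mul_sum]
  exact add_le_add (by linarith) (Finset.sum_le_sum hone)

/-- Active policies whose diameters never fall below `ε` are `ε`-separated. -/
theorem IsRun.separated (h : IsRun M O C α LJ cd δ T s π act) (hO : IsCoveringOracle Φ ρΦ O)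
    (ht : t < T) {Y : Finset (Policy S A)} (hY : Y ⊆ act t) {ε : ℝ}
    (hε : ∀ φ ∈ Y, ∀ u < T, ε ≤ policyDiam C α cd δ T π u φ) :
    (Y : Set (Policy S A)).Pairwise fun a b =>
      ¬ (ρΦ a b ≤ ENNReal.ofReal ε ∧ ρΦ b a ≤ ENNReal.ofReal ε) := by
  have hp := h.act_pairwise hO (Sep := fun φ ψ =>
      (∃ u < T, ¬ ρΦ ψ φ ≤ ENNReal.ofReal (policyDiam C α cd δ T π u φ)) ∨
      (∃ u < T, ¬ ρΦ φ ψ ≤ ENNReal.ofReal (policyDiam C α cd δ T π u ψ)))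
    (fun φ ψ => Or.symm) (fun u hu φ ψ hnot => Or.inl ⟨u, hu, hnot⟩) ht
  intro a ha b hb hne ⟨hab, hba⟩
  rcases hp (hY ha) (hY hb) hne with ⟨u, hu, hnot⟩ | ⟨u, hu, hnot⟩
  · exact hnot (hba.trans (ENNReal.ofReal_le_ofReal (hε a ha u hu)))
  · exact hnot (hab.trans (ENNReal.ofReal_le_ofReal (hε b hb u hu)))

/-- The regret bound on a clean trajectory. -/
theorem IsRun.regret_le {cz₁ cz₂ Cub d : ℝ} (h : IsRun M O C α LJ cd δ T s π act) (hT : 1 ≤ T)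
    (hO : IsCoveringOracle Φ ρΦ O)
    (hcl : Clean M μ₀ Φ (C / (1 - α)) (cd * Real.log (T / δ)) T s π)
    (hc : 0 < C / (1 - α)) (hx : 1 ≤ cd * Real.log (T / δ))
    (hbig : 1 ≤ C / (1 - α) * (√(cd * Real.log (T / δ)) + 1))
    (hJ : ∀ φ ∈ Φ, avgReward M μ₀ φ ∈ Set.Icc (0 : ℝ) 1) (hopt : optReward M μ₀ Φ ≤ 1)
    (hLJ : 0 ≤ LJ)
    (hlip : ∀ φ ∈ Φ, ∀ ψ ∈ Φ,
      ENNReal.ofReal |avgReward M μ₀ φ - avgReward M μ₀ ψ| ≤ ENNReal.ofReal LJ * ρΦ φ ψ)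
    (hΦ : Φ.Nonempty) (hcz₁ : 0 ≤ cz₁) (hcz₂ : 0 ≤ cz₂) (hd : 0 ≤ d)
    (hcov : ∀ γ : ℝ, 0 < γ → γ ≤ 1 →
      (coveringNumber ρΦ (γ / scaleConst Cub LJ) (layer M μ₀ Φ γ) : ℝ≥0∞) ≤
        ENNReal.ofReal (cz₁ * γ ^ (-d)) ∧
      (coveringNumber ρΦ (γ / scaleConst Cub LJ) (nearOpt M μ₀ Φ γ) : ℝ≥0∞) ≤
        ENNReal.ofReal (cz₂ * γ ^ (-d))) :
    regret M μ₀ Φ T s π ≤ (C / (1 - α)) ^ 2 * (4 + (8 * (2 + LJ) + 4) *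
      (2 + cz₂ * scaleConst Cub LJ + 2 * (cz₁ * (8 * (2 + LJ))))) *
        (cd * Real.log (T / δ)) * (T : ℝ) ^ (1 - 1 / (d + 2)) := by
  obtain ⟨n, rfl⟩ : ∃ n, T = n + 1 := ⟨T - 1, by lia⟩
  set x := cd * Real.log ((n + 1 : ℕ) / δ) with hxdef
  set c := C / (1 - α) with hcdef
  set cz := scaleConst Cub LJ with hcz
  set G := c * √x with hG
  set b := 8 * (2 + LJ) with hb
  have hx0 : 0 ≤ x := by linarith
  have hx1 : 1 ≤ √x := Real.one_le_sqrt.2 hx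
  have hG2 : G ^ 2 = c ^ 2 * x := by rw [hG, mul_pow, Real.sq_sqrt hx0]
  have hGhalf : 1 / 2 ≤ G := by nlinarith
  have hczLJ : 2 * (2 + LJ) ≤ cz := by
    rw [hcz, scaleConst]; linarith [le_max_left 2 Cub]
  have hcz4 : 4 ≤ cz := by linarith
  have hnew : ∀ t < n + 1, NewEpisode π t →
      gap M μ₀ Φ (π t) ≤ (2 + LJ) * policyDiam C α cd δ (n + 1) π t (π t) := fun t ht hn =>
    h.gap_le_of_newEpisode hO hcl hc hx0 hbig hJ hLJ hlip hΦ ht hn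
  have hactΦ := h.act_subset hO n.lt_succ_self
  have hgap1 : ∀ φ ∈ act n, gap M μ₀ Φ φ ≤ 1 := fun φ hφ => by
    have := (hJ φ (hactΦ hφ)).1
    unfold gap; linarith
  have hreg := h.regret_le_sum_sqrt hO hcl hnew hc hx hLJ hopt
  -- the scale below which gaps are not resolved
  set γ : ℝ := ((n + 1 : ℕ) : ℝ) ^ (-(1 / (d + 2))) with hγ
  have hT0 : (0 : ℝ) < (n + 1 : ℕ) := Nat.cast_pos.2 n.succ_pos
  have hT1 : (1 : ℝ) ≤ (n + 1 : ℕ) := Nat.one_le_cast.2 hT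
  have hd2 : 0 < d + 2 := by linarith
  have hγ0 : 0 < γ := Real.rpow_pos_of_pos hT0 _
  have hγ1 : γ ≤ 1 := Real.rpow_le_one_of_one_le_of_nonpos hT1 (by
    rw [neg_nonpos]; positivity)
  set R : ℝ := ((n + 1 : ℕ) : ℝ) ^ (1 - 1 / (d + 2)) with hR
  have hR1 : 1 ≤ R := Real.one_le_rpow hT1 (by
    rw [sub_nonneg, div_le_one hd2]; linarith)
  have hγT : γ * (n + 1 : ℕ) = R := by
    rw [hγ, hR, ← Real.rpow_add_one hT0.ne']; congr 1; ring
  have hγd : γ ^ (-d) / γ = R := by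
    rw [← Real.rpow_sub_one hγ0.ne', hγ, hR, ← Real.rpow_mul hT0.le]
    congr 1
    field_simp
    ring
  have hdiam : ∀ φ ∈ act n, ∀ u < n + 1,
      gap M μ₀ Φ φ ≤ cz * policyDiam C α cd δ (n + 1) π u φ := fun φ hφ u hu =>
    (h.gap_le_policyDiam hnew hc hx0 hbig hLJ (hgap1 φ hφ) hu.le).trans
      (mul_le_mul_of_nonneg_right hczLJ (policyDiam_nonneg hc.le _ _ _))
  have hsum : ∑ φ ∈ act n, √(playCount π n φ) ≤
      γ * (n + 1 : ℕ) + (cz₂ * (G * cz) + 2 * (cz₁ * (b * G))) * (γ ^ (-d) / γ) := by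
    refine sum_le_of_layers (g := gap M μ₀ Φ) hgap1 (by positivity) (fun φ hφ => ?_)
      (fun φ _ => Real.sqrt_nonneg _) hcz₁ hd (by nlinarith) ?_ ?_ hγ0 ?_
    · rcases Nat.eq_zero_or_pos (playCount π n φ) with h0 | hpos
      · rw [h0, Nat.cast_zero, Real.sqrt_zero, zero_mul]; positivity
      · have h1 := (h.playCount_mul_gap_le hnew hc hx hLJ n.le_succ hpos).1
        have hs : 0 < √(playCount π n φ : ℝ) := Real.sqrt_pos.2 (Nat.cast_pos.2 hpos)
        rw [show (playCount π n φ : ℝ) = √(playCount π n φ : ℝ) * √(playCount π n φ : ℝ) from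
          (Real.mul_self_sqrt (Nat.cast_nonneg _)).symm, Real.sqrt_mul_self hs.le] at h1
        refine le_of_mul_le_mul_right ?_ hs
        linarith
    · simp only [Real.sq_sqrt (Nat.cast_nonneg _)]
      exact_mod_cast (sum_playCount_le π n (act n)).trans n.le_succ
    · intro β hβ hβ1 Y hY hYβ
      refine card_le_of_coveringNumber_le (Y := layer M μ₀ Φ β) (fun φ hφ =>
        ⟨hactΦ (hY hφ), (hYβ φ hφ).1, (hYβ φ hφ).2⟩)
        (h.separated hO n.lt_succ_self hY fun φ hφ u hu => ?_) (by positivity) (hcov β hβ hβ1).1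
      rw [div_le_iff₀ (by linarith), mul_comm]
      exact (hYβ φ hφ).1.le.trans (hdiam φ (hY hφ) u hu)
    · intro Y hY hYγ
      refine card_le_of_coveringNumber_le (Y := nearOpt M μ₀ Φ γ) (fun φ hφ =>
        ⟨hactΦ (hY hφ), (hYγ φ hφ).1⟩)
        (h.separated hO n.lt_succ_self hY fun φ hφ u hu => ?_) (by positivity)
        (hcov γ hγ0 hγ1).2
      -- few plays keep the diameter large
      set m : ℕ := max 1 (playCount π u φ) with hm
      have hm0 : (0 : ℝ) < m := Nat.cast_pos.2 (lt_of_lt_of_le Nat.one_pos (le_max_left _ _))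
      have hsm : √(m : ℝ) ≤ G * cz / γ := by
        rcases le_total (playCount π u φ) 1 with hle | hle
        · rw [hm, max_eq_left hle, Nat.cast_one, Real.sqrt_one, le_div_iff₀ hγ0]
          nlinarith
        · rw [hm, max_eq_right hle]
          refine le_trans (Real.sqrt_le_sqrt (Nat.cast_le.2 ?_)) (hYγ φ hφ).2
          exact playCount_mono π φ (Nat.lt_succ_iff.1 hu)
      have hsm0 : 0 < √(m : ℝ) := Real.sqrt_pos.2 hm0
      have h1 : γ / cz ≤ G / √(m : ℝ) := by
        rw [le_div_iff₀ hγ0] at hsm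
        rw [div_le_div_iff₀ (by linarith) hsm0]
        linarith
      refine h1.trans ?_
      have h2 : policyDiam C α cd δ (n + 1) π u φ =
        c * (√(x / (m : ℝ)) + (1 + episodeCount π u φ) / (m : ℝ)) := rfl
      rw [h2, hG, mul_div_assoc, ← Real.sqrt_div hx0]
      refine mul_le_mul_of_nonneg_left (le_add_of_nonneg_right (by positivity)) hc.le
  rw [hγT, hγd] at hsum
  have hb0 : 0 ≤ b := by positivity
  set K := cz₂ * cz + 2 * (cz₁ * b) with hK
  have hK0 : 0 ≤ K := by positivity
  have hsum' : ∑ φ ∈ act n, √(playCount π n φ) ≤ R * (1 + K * G) := by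
    refine hsum.trans (le_of_eq ?_); rw [hK]; ring
  have hGG : G ≤ 2 * G ^ 2 := by nlinarith
  have h4G : 1 ≤ 4 * G ^ 2 := by nlinarith
  calc regret M μ₀ Φ (n + 1) s π ≤ 1 + (b + 4) * G * (R * (1 + K * G)) :=
        hreg.trans (by gcongr)
    _ = 1 + (b + 4) * R * (G + K * G ^ 2) := by ring
    _ ≤ 4 * G ^ 2 * R + (b + 4) * R * (2 * G ^ 2 + K * G ^ 2) := by
        refine add_le_add (by nlinarith) ?_
        refine mul_le_mul_of_nonneg_left (by linarith) (by positivity)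
    _ = G ^ 2 * (4 + (b + 4) * (2 + K)) * R := by ring
    _ = c ^ 2 * (4 + (b + 4) * (2 + cz₂ * cz + 2 * (cz₁ * b))) * x * R := by
        rw [hG2, hK]; ring

end Regret

/-! ### The confidence level -/

/-- The requirement on `cd` makes the failure probability of one comparison, `2 * exp (-2 x)` with
`x = cd * log (T / δ)`, at most `δ / T ^ 2`, which pays for the union bound. -/
theorem le_exp_of_requirement {Cub LJ cd d δ : ℝ} {T : ℕ} (hLJ : 0 ≤ LJ) (hd : 0 ≤ d) (hT : 1 ≤ T)
    (hδ : 0 < δ) (hδ1 : δ < 1)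
    (h : Real.log (scaleConst Cub LJ / δ * (2 : ℝ) ^ (d + 2) * (T : ℝ) ^ ((d + 3) / (d + 2))) /
      Real.log (T / δ) ≤ cd) :
    16 * (T / δ) ≤ Real.exp (cd * Real.log (T / δ)) := by
  have hT1 : (1 : ℝ) ≤ T := Nat.one_le_cast.2 hT
  have hTδ : 1 < T / δ := by rw [lt_div_iff₀ hδ]; linarith
  rw [div_le_iff₀ (Real.log_pos hTδ)] at h
  have hcz : 4 ≤ scaleConst Cub LJ := by
    rw [scaleConst]; linarith [le_max_left 2 Cub]
  have h2 : (4 : ℝ) ≤ (2 : ℝ) ^ (d + 2) := by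
    calc (4 : ℝ) = (2 : ℝ) ^ (2 : ℝ) := by norm_num
      _ ≤ _ := Real.rpow_le_rpow_of_exponent_le one_le_two (by linarith)
  have h3 : (T : ℝ) ≤ (T : ℝ) ^ ((d + 3) / (d + 2)) := by
    refine Real.self_le_rpow_of_one_le hT1 ?_
    rw [le_div_iff₀ (by linarith)]; linarith
  have h4 : 16 * (T / δ) ≤
      scaleConst Cub LJ / δ * (2 : ℝ) ^ (d + 2) * (T : ℝ) ^ ((d + 3) / (d + 2)) := by
    calc 16 * (T / δ) = 4 / δ * 4 * T := by ring
      _ ≤ _ := by gcongr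
  calc _ ≤ _ := h4
    _ = Real.exp (Real.log _) := (Real.exp_log (lt_of_lt_of_le (by positivity) h4)).symm
    _ ≤ _ := Real.exp_le_exp.2 h

end PZRL

end

theorem theorem2 (C α LJ Cub cz₁ cz₂ cd d : ℝ) (hC : 0 < C) (hα : 0 < α) (hα' : α < 1)
    (hcz₁ : 0 < cz₁) (hcz₂ : 0 < cz₂) :
    ∃ (K : ℝ) (q : ℕ),
      ∀ (S A : Type*) [MetricSpace S] [MeasurableSpace S] [BorelSpace S]
        [MetricSpace A] [MeasurableSpace A] [BorelSpace A]
        (M : PZRL.MDP S A) (μ₀ : Measure S) [IsProbabilityMeasure μ₀]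
        (ρ : S × A → S × A → ℝ) (Lr Lp : ℝ)
        (Φ : Set (PZRL.Policy S A)) (ρΦ : PZRL.Policy S A → PZRL.Policy S A → ℝ≥0∞),
        PZRL.IsSubadditiveMetric ρ →
        PZRL.IsLipschitzMDP M ρ Lr Lp →
        Φ.Nonempty →
        PZRL.UniformlyErgodic M C α Φ →
        PZRL.AdmissibleMetric M μ₀ Φ C α Lr Lp ρΦ LJ →
        (PZRL.zoomingSet M μ₀ Φ ρΦ (PZRL.scaleConst Cub LJ) cz₁ cz₂).Nonempty →
        PZRL.zoomingDim M μ₀ Φ ρΦ (PZRL.scaleConst Cub LJ) cz₁ cz₂ = d →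
        ∀ (T : ℕ) (δ : ℝ), 1 ≤ T → 0 < δ → δ < 1 →
          Real.log (PZRL.scaleConst Cub LJ / δ * (2 : ℝ) ^ (d + 2) *
            (T : ℝ) ^ ((d + 3) / (d + 2))) / Real.log (T / δ) ≤ cd →
          ∀ (O : Finset (PZRL.Policy S A × ℝ) → Option (PZRL.Policy S A)),
            PZRL.IsCoveringOracle Φ ρΦ O →
            ∀ (Ω : Type*) [mΩ : MeasurableSpace Ω] (P : Measure Ω) [IsProbabilityMeasure P]
              (ℱ : Filtration ℕ mΩ) (s : ℕ → Ω → S) (π : ℕ → Ω → PZRL.Policy S A)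
              (act : ℕ → Ω → Finset (PZRL.Policy S A)),
              PZRL.IsProcess P M μ₀ O C α LJ cd δ T ℱ s π act →
              ENNReal.ofReal (1 - δ) ≤
                P {ω | PZRL.regret M μ₀ Φ T (fun t => s t ω) (fun t => π t ω) ≤
                  K * Real.log (T / δ) ^ q * (T : ℝ) ^ (1 - 1 / (d + 2))} := by
  have h1α : 0 < 1 - α := by linarith
  set c := C / (1 - α) with hcdef
  have hc : 0 < c := by positivity
  -- `K₁` serves clean trajectories, `K₂` the horizons that are too short for optimism.
  set K₁ := c ^ 2 * (4 + (8 * (2 + LJ) + 4) *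
      (2 + cz₂ * PZRL.scaleConst Cub LJ + 2 * (cz₁ * (8 * (2 + LJ))))) with hK₁
  set K₂ := Real.exp (1 / c ^ 2) with hK₂
  refine ⟨(K₁ + K₂) * cd, 1, ?_⟩
  intro S A _ _ _ _ _ _ M μ₀ _ ρ Lr Lp Φ ρΦ hρ hM hΦ hE hadm hne hdim T δ hT hδ hδ1 hcd O hO Ω mΩ P
    _ ℱ s π act h
  obtain ⟨hLJ, hlip⟩ := hadm.lipschitz hρ hM hE hC hα hα'
  have hd : 0 ≤ d := hdim ▸ PZRL.zoomingDim_nonneg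
  have hT1 : (1 : ℝ) ≤ T := Nat.one_le_cast.2 hT
  have hTδ : (T : ℝ) ≤ T / δ := le_div_self (by linarith) hδ hδ1.le
  have hexp := PZRL.le_exp_of_requirement hLJ hd hT hδ hδ1 hcd
  set x := cd * Real.log (T / δ) with hxdef
  have hx : 1 ≤ x := by
    rw [← Real.exp_le_exp]
    linarith [Real.exp_one_lt_d9]
  have hR : 1 ≤ (T : ℝ) ^ (1 - 1 / (d + 2)) := Real.one_le_rpow hT1 (by
    rw [sub_nonneg, div_le_one (by linarith)]; linarith)
  set R := (T : ℝ) ^ (1 - 1 / (d + 2))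
  have hcz : 0 < PZRL.scaleConst Cub LJ := by
    rw [PZRL.scaleConst]; linarith [le_max_left 2 Cub]
  have hK₁0 : 0 ≤ K₁ := by positivity
  have hK₂0 : 0 < K₂ := Real.exp_pos _
  have hopt := PZRL.optReward_le_one (μ₀ := μ₀) hE hC.le hα.le hα' hΦ
  have hbound : (K₁ + K₂) * cd * Real.log (T / δ) ^ 1 * R = K₁ * x * R + K₂ * x * R := by
    rw [hxdef]; ring
  rw [hbound]
  have hA1 : 0 ≤ K₁ * x * R := by positivity
  have hA2 : 0 ≤ K₂ * x * R := by positivity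
  rcases lt_or_ge (c * (√x + 1)) 1 with hsmall | hbig
  -- If the initial diameter is below the range of the rewards, then unplayed policies need not be
  -- optimistic, but this happens only for bounded horizons.
  · have hxc : x ≤ 1 / c ^ 2 := by
      have h1 : √x ≤ 1 / c := by rw [le_div_iff₀ hc]; nlinarith
      rw [← Real.sq_sqrt (by linarith : 0 ≤ x), ← one_div_pow]
      exact pow_le_pow_left₀ (Real.sqrt_nonneg x) h1 2
    have hTK : (T : ℝ) ≤ K₂ * x * R := by
      have h1 : (T : ℝ) ≤ K₂ := by
        have := Real.exp_le_exp.2 hxc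
        linarith
      nlinarith [mul_nonneg hK₂0.le (by linarith : 0 ≤ x)]
    have hall : {ω | PZRL.regret M μ₀ Φ T (fun t => s t ω) (fun t => π t ω) ≤
        K₁ * x * R + K₂ * x * R} = Set.univ := by
      refine Set.eq_univ_of_forall fun ω => ?_
      have h1 : 0 ≤ ∑ t ∈ Finset.range T, M.r (s t ω, (π t ω).1 (s t ω)) :=
        Finset.sum_nonneg fun t _ => (M.r_mem _).1
      rw [Set.mem_ofPred_eq, PZRL.regret]
      nlinarith
    rw [hall, measure_univ]
    exact ENNReal.ofReal_le_one.2 (by linarith)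
  · have hxδ : T * T * (2 * Real.exp (-(2 * x))) ≤ δ := by
      have hT0 : (0 : ℝ) < T := by linarith
      have h1 : Real.exp (-x) ≤ δ / (16 * T) := by
        rw [Real.exp_neg, ← inv_div]
        refine inv_anti₀ (by positivity) ?_
        rwa [← mul_div_assoc] at hexp
      have h2 : Real.exp (-(2 * x)) ≤ (δ / (16 * T)) ^ 2 := by
        rw [show -(2 * x) = -x + -x by ring, Real.exp_add, sq]
        exact mul_le_mul h1 h1 (Real.exp_pos _).le (by positivity)
      calc T * T * (2 * Real.exp (-(2 * x))) ≤ T * T * (2 * (δ / (16 * T)) ^ 2) := by gcongr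
        _ = δ ^ 2 / 128 := by field_simp; norm_num
        _ ≤ δ := by nlinarith
    refine (h.ofReal_le_measure_clean hO hE hC hα hα' (by linarith) hδ.le hxδ).trans
      (measure_mono fun ω hω => ?_)
    have := (h.run ω).regret_le (Cub := Cub) hT hO hω hc hx hbig
      (fun φ hφ => PZRL.avgReward_mem_Icc hE hC.le hα.le hα' hφ) hopt hLJ hlip hΦ hcz₁.le hcz₂.le hd
      (fun γ hγ hγ1 => by
        have := PZRL.coveringNumber_le_zoomingDim hne hcz₁.le hcz₂.le hγ hγ1
        rwa [hdim] at this)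
    rw [Set.mem_ofPred_eq]
    linarith
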